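/- Let $K$ be a field of characteristic zero and let $A_2 = K\langle x_1, x_2\rangle$ be the free unital associative algebra on two generators. For a unital associative $K$-algebra $R$ put $[a,b]=ab-ba$, $L_1(R)=R$, $L_{i+1}(R)=[R,L_i(R)]$ (linear span of the commutators), $M_i(R)=R\,L_i(R)\,R$ (the two-sided ideal generated by $L_i(R)$) and $N_i(R)=M_i(R)/M_{i+1}(R)$. Let $$R_{2,3}(A_2) = A_2/\bigl(M_2(A_2)\,M_3(A_2)\bigr).$$ The group $GL_2=GL_2(K)$ acts on $A_2$ by linear substitutions of the generators, $g\cdot x_j=\sum_i g_{ij}x_i$; this action is by algebra automorphisms and therefore induces an action on $R_{2,3}(A_2)$ and on each $N_r(R_{2,3}(A_2))$. For a partition $a\ge b\ge 0$ let $Y_2(a,b)=\mathrm{Sym}^{a-b}(K^2)\otimes\det^{b}$ be the irreducible polynomial $GL_2$-module associated with $(a,b)$, and write $Y_2(i)=Y_2(i,0)$. **Theorem (Structure Theorem for $R_{2,3}$).** For every integer $r>4$ there is an isomorphism of $GL_2$-modules $$N_r(R_{2,3}(A_2)) \;\cong\; \Bigl(\bigoplus_{i\ge 0} Y_2(i)\Bigr)\otimes\Bigl(Y_2(r-1,1)\,\oplus\,\bigl(Y_2(r-3,1)\otimes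 Y_2(1,1)\bigr)\Bigr).$$ -/

import Mathlib

namespace LCS

section General

/-- `L_i(R)`: `L_1(R) = R` and `L_{i+1}(R) = [R, L_i(R)]`, the linear span of all commutators
`[a, b] = ab - ba` with `a ∈ R` and `b ∈ L_i(R)`. The index `0` is not used (`L_0(R) = R`). -/
def L (K R : Type*) [CommRing K] [Ring R] [Algebra K R] : ℕ → Submodule K R
  | 0 => ⊤
  | 1 => ⊤
  | i + 2 => Submodule.span K {x | ∃ a : R, ∃ b ∈ L K R (i + 1), x = a * b - b * a}

/-- `M_i(R) = R · L_i(R) · R`, the two-sided ideal generated by `L_i(R)`, as a subspace of `R`. -/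
def M (K R : Type*) [CommRing K] [Ring R] [Algebra K R] (i : ℕ) : Submodule K R :=
  ⊤ * L K R i * ⊤

/-- `N_i(R) = M_i(R) / M_{i+1}(R)`. -/
abbrev N (K R : Type*) [CommRing K] [Ring R] [Algebra K R] (i : ℕ) : Type _ :=
  ↥(M K R i) ⧸ (M K R (i + 1)).submoduleOf (M K R i)

variable {K R S : Type*} [CommRing K] [Ring R] [Algebra K R] [Ring S] [Algebra K S]

theorem L_map_le (f : R →ₐ[K] S) : ∀ i : ℕ, (L K R i).map f.toLinearMap ≤ L K S i
  | 0 => le_top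
  | 1 => le_top
  | i + 2 => by
    rw [L, L, Submodule.map_span, Submodule.span_le]
    rintro _ ⟨_, ⟨a, b, hb, rfl⟩, rfl⟩
    exact Submodule.subset_span ⟨f a, f b, L_map_le f (i + 1) ⟨b, hb, rfl⟩, by simp⟩

theorem M_map_le (f : R →ₐ[K] S) (i : ℕ) : (M K R i).map f.toLinearMap ≤ M K S i := by
  unfold M
  rw [Submodule.map_mul, Submodule.map_mul]
  exact mul_le_mul' (mul_le_mul' le_top (L_map_le f i)) le_top

theorem top_mul_M (i : ℕ) : ⊤ * M K R i ≤ M K R i := by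
  unfold M
  rw [← mul_assoc, ← mul_assoc]
  exact mul_le_mul' (mul_le_mul' le_top le_rfl) le_rfl

theorem M_mul_top (i : ℕ) : M K R i * ⊤ ≤ M K R i := by
  unfold M
  rw [mul_assoc]
  exact mul_le_mul' le_rfl le_top

/-- The product `M_i(R) · M_j(R)` (the linear span of all products), as a left ideal of `R`; it
is two-sided by the instance below. -/
def mulIdeal (K R : Type*) [CommRing K] [Ring R] [Algebra K R] (i j : ℕ) : Ideal R where
  carrier := (M K R i * M K R j : Submodule K R)
  add_mem' := fun ha hb => Submodule.add_mem _ ha hb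
  zero_mem' := Submodule.zero_mem _
  smul_mem' := fun c x hx => by
    have h : ⊤ * (M K R i * M K R j) ≤ M K R i * M K R j := by
      rw [← mul_assoc]
      exact mul_le_mul' (top_mul_M i) le_rfl
    exact h (Submodule.mul_mem_mul (Submodule.mem_top (x := c)) hx)

instance mulIdeal_isTwoSided (i j : ℕ) : (mulIdeal K R i j).IsTwoSided where
  mul_mem_of_left := fun {a} b ha => by
    have h : (M K R i * M K R j) * ⊤ ≤ M K R i * M K R j := by
      rw [mul_assoc]
      exact mul_le_mul' le_rfl (M_mul_top j)
    exact h (Submodule.mul_mem_mul ha (Submodule.mem_top (x := b)))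

theorem mulIdeal_le_comap (f : R →ₐ[K] S) (i j : ℕ) :
    mulIdeal K R i j ≤ (mulIdeal K S i j).comap f := by
  intro x hx
  have h : (M K R i * M K R j).map f.toLinearMap ≤ M K S i * M K S j := by
    rw [Submodule.map_mul]
    exact mul_le_mul' (M_map_le f i) (M_map_le f j)
  exact h ⟨x, hx, rfl⟩

/-- The algebra `R / (M_i(R) · M_j(R))`; for `R = A_n` this is `R_{i,j}(A_n)`. -/
abbrev PIQuot (K R : Type*) [CommRing K] [Ring R] [Algebra K R] (i j : ℕ) : Type _ :=
  R ⧸ mulIdeal K R i j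

variable {G : Type*} [Monoid G]

/-- An action of `G` on `R` by algebra endomorphisms descends to `R / (M_i(R) · M_j(R))`. -/
def quotAction (α : G →* (R →ₐ[K] R)) (i j : ℕ) :
    G →* (PIQuot K R i j →ₐ[K] PIQuot K R i j) where
  toFun g := Ideal.quotientMapₐ _ (α g) (mulIdeal_le_comap (α g) i j)
  map_one' := by
    refine Ideal.Quotient.algHom_ext K (AlgHom.ext fun x => ?_)
    simp
  map_mul' g h := by
    refine Ideal.Quotient.algHom_ext K (AlgHom.ext fun x => ?_)
    simp

/-- An action `α` of `G` on `R` by algebra endomorphisms, viewed as a linear representation. -/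
def linRep (α : G →* (R →ₐ[K] R)) : Representation K G R where
  toFun g := (α g).toLinearMap
  map_one' := by ext; simp
  map_mul' g h := by ext; simp

theorem M_le_comap (α : G →* (R →ₐ[K] R)) (i : ℕ) (g : G) :
    M K R i ≤ (M K R i).comap (linRep α g) :=
  fun x hx => M_map_le (α g) i ⟨x, hx, rfl⟩

/-- The representation of `G` on `N_i(R) = M_i(R) / M_{i+1}(R)` induced by an action of `G` on `R`
by algebra endomorphisms. -/
def nRep (α : G →* (R →ₐ[K] R)) (i : ℕ) : Representation K G (N K R i) :=
  ((linRep α).subrepresentation (M K R i) (M_le_comap α i)).quotient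
    ((M K R (i + 1)).submoduleOf (M K R i))
    (fun g _ hx => M_le_comap α (i + 1) g hx)

end General

section LinearSubstitutions

variable (K : Type*) [CommRing K] (n : ℕ)

/-- `GL_n(K)` acts on the free associative algebra `A_n = K⟨x_1, …, x_n⟩` by linear substitutions
of the generators, `g • x_j = ∑ i, g_{ij} x_i`. -/
noncomputable def freeAction :
    Matrix.GeneralLinearGroup (Fin n) K →* (FreeAlgebra K (Fin n) →ₐ[K] FreeAlgebra K (Fin n)) where
  toFun g := FreeAlgebra.lift K fun j => ∑ i, (g i j : K) • FreeAlgebra.ι K i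
  map_one' := by
    ext j
    simp [Matrix.one_apply, ite_smul]
  map_mul' g h := by
    ext j
    simp only [Function.comp_apply, FreeAlgebra.lift_ι_apply, AlgHom.mul_apply, map_sum, map_smul,
      Units.val_mul, Matrix.mul_apply, Finset.sum_smul, Finset.smul_sum, smul_smul]
    rw [Finset.sum_comm]
    simp only [mul_comm]

/-- `GL_n(K)` acts on the polynomial algebra `K[x_1, …, x_n]` by the same linear substitutions,
`g • x_j = ∑ i, g_{ij} x_i`. -/
noncomputable def polyAction :
    Matrix.GeneralLinearGroup (Fin n) K →* (MvPolynomial (Fin n) K →ₐ[K] MvPolynomial (Fin n) K) where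
  toFun g := MvPolynomial.aeval fun j => ∑ i, (g i j : K) • MvPolynomial.X i
  map_one' := by
    ext1 j
    simp [Matrix.one_apply, ite_smul]
  map_mul' g h := by
    ext1 j
    simp only [MvPolynomial.aeval_X, AlgHom.mul_apply, map_sum, map_smul,
      Units.val_mul, Matrix.mul_apply, Finset.sum_smul, Finset.smul_sum, smul_smul]
    rw [Finset.sum_comm]
    simp only [mul_comm]

/-- The representation of `GL_n(K)` on `Sym^d(V)`, where `V = K^n` is the standard module:
`Sym^d(V)` is the space of homogeneous polynomials of degree `d` in the standard basis
`x_1, …, x_n` of `V`. -/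
noncomputable def symRep (d : ℕ) :
    Representation K (Matrix.GeneralLinearGroup (Fin n) K) (MvPolynomial.homogeneousSubmodule (Fin n) K d) :=
  (linRep (polyAction K n)).subrepresentation _ fun g p hp => by
    have h := MvPolynomial.IsHomogeneous.aeval (n := 1) (S := K)
      ((MvPolynomial.mem_homogeneousSubmodule d p).1 hp)
      (fun j => ∑ i, (g i j : K) • (MvPolynomial.X i : MvPolynomial (Fin n) K))
      (fun j => MvPolynomial.IsHomogeneous.sum _ _ _ fun i _ => by
        rw [MvPolynomial.smul_eq_C_mul]
        exact MvPolynomial.IsHomogeneous.C_mul (MvPolynomial.isHomogeneous_X K i) _)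
    rw [one_mul] at h
    exact (MvPolynomial.mem_homogeneousSubmodule d _).2 h

/-- The space of the `GL_2`-module `Y_2(a, b)`, for a partition `a ≥ b ≥ 0`. -/
abbrev Y₂ (a b : ℕ) : Type _ := MvPolynomial.homogeneousSubmodule (Fin 2) K (a - b)

/-- The irreducible polynomial `GL_2`-module `Y_2(a, b)` associated with the partition
`a ≥ b ≥ 0`, namely `Sym^{a-b}(V) ⊗ det^b` with `V = K^2` the standard module (so that the action
of `g` on `Sym^{a-b}(V)` is twisted by the scalar `det(g)^b`). One writes `Y_2(i) = Y_2(i, 0)`. -/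
noncomputable def Y₂rep (a b : ℕ) : Representation K (Matrix.GeneralLinearGroup (Fin 2) K) (Y₂ K a b) where
  toFun g := (Matrix.GeneralLinearGroup.det g : K) ^ b • symRep K 2 (a - b) g
  map_one' := by simp
  map_mul' g h := by
    ext x
    simp [mul_pow, smul_smul, mul_comm]

/-- The representation of `GL_n(K)` on `N_r(R_{i,j}(A_n))`, induced by linear substitutions of the
generators of `A_n`. -/
noncomputable def nQuotRep (i j r : ℕ) :
    Representation K (Matrix.GeneralLinearGroup (Fin n) K) (N K (PIQuot K (FreeAlgebra K (Fin n)) i j) r) :=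
  nRep (quotAction (freeAction K n) i j) r

end LinearSubstitutions

end LCS

namespace LCS

/-! ### Commutator calculus in an arbitrary algebra. -/

section General

variable {K R : Type*} [CommRing K] [Ring R] [Algebra K R]

/-! Write `R` for the quotient, `w = [x₁, x₂]` and `r = m + 5`. The proof gives explicit spanning
elements of `M_r` modulo `M_{r+1}` and separates them by a triangular matrix representation.

Spanning. In `R` one has `M_2 M_3 = 0`. Since `w² ∈ M_3`, also `M_2 M_2 ⊆ M_3`, hence `M_2³ = 0`.
Modulo `M_3` every element of `M_2` lies in `w R`, so behind a factor from `M_2` any further factor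
from `M_2` may be replaced by `w u`, and `w` commutes with everything there. Let `ad u (w)` be the
iterated commutator of `w` with the letters of a word `u`. By induction `M_{k+3}` lies in the span
of `ad u (w) a` with `|u| ≥ k + 1` and `ad u (w) w a` with `|u| ≥ k` (`M_le_adIdeal_sup`).
Conversely, for `|u| ≥ 1`, `w · ad u (w) = 0` makes `ad u (w) w` a commutator with an element of
`L_2`, which gains two steps (`adCommIdeal_le_M`); hence the shift from `r - 1` to `r - 3`.
Reordering the letters of `u` costs only terms of the second kind, and in those it costs nothing. So
symmetrizations of polynomials suffice, both for `u` and for `a` (`M_le_of_symD_mem`).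

Independence. `triRep` sends `A_2` to upper triangular 4×4 matrices over `K[t₁, t₂][s₁, s₂]`. It
kills `M_2 M_3` and sends `M_{j+3}` to matrices whose (0,1) and (0,3) entries lie in the powers `j +
2` and `j` of the ideal `(s₁, s₂)` (`map_M_mem_rowFiltration`). The first family shows `q(t) f(s)
s₁` in entry (0,1); the second shows the same in entry (0,3) and zero in (0,1). Comparing degrees in
`s` shows independence modulo `M_{r+1}` (`eq_zero_of_comparison_mem`).

Symmetrization is `GL_2`-equivariant and `w` spans a copy of `det`, so the resulting bijection is an
isomorphism of modules (`quotAction_comparison`). -/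

theorem commutator_mem_L {i : ℕ} (a : R) {b : R} (hb : b ∈ L K R (i + 1)) :
    a * b - b * a ∈ L K R (i + 2) := by
  rw [L]
  exact Submodule.subset_span ⟨a, b, hb, rfl⟩

theorem L_succ_le : ∀ i : ℕ, L K R (i + 1) ≤ L K R i
  | 0 => le_top
  | 1 => le_top
  | i + 2 => by
    rw [L, Submodule.span_le]
    rintro _ ⟨a, b, hb, rfl⟩
    exact commutator_mem_L a (L_succ_le (i + 1) hb)

theorem mul_mem_M_left {i : ℕ} (a : R) {b : R} (hb : b ∈ M K R i) : a * b ∈ M K R i :=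
  top_mul_M i (Submodule.mul_mem_mul Submodule.mem_top hb)

theorem mul_mem_M_right {i : ℕ} {b : R} (hb : b ∈ M K R i) (a : R) : b * a ∈ M K R i :=
  M_mul_top i (Submodule.mul_mem_mul hb Submodule.mem_top)

theorem L_le_M (i : ℕ) : L K R i ≤ M K R i := fun b hb => by
  have := Submodule.mul_mem_mul (Submodule.mul_mem_mul (Submodule.mem_top (R := K) (x := (1 : R))) hb)
    (Submodule.mem_top (R := K) (x := (1 : R)))
  simpa [M] using this

theorem M_le_of_L_le {i : ℕ} {G : Submodule K R} (hl : ∀ a, ∀ z ∈ G, a * z ∈ G)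
    (hr : ∀ z ∈ G, ∀ a, z * a ∈ G) (h : L K R i ≤ G) : M K R i ≤ G := by
  unfold M
  rw [Submodule.mul_le]
  intro z hz c _
  refine hr z ?_ c
  revert z
  change ⊤ * L K R i ≤ G
  rw [Submodule.mul_le]
  exact fun a _ b hb => hl a b (h hb)

/-- Jacobi identity: `[c, [a, b]] = [b, [a, c]] - [a, [b, c]]`. -/
theorem commutator_L_two_mem {k : ℕ} {c d : R} (hc : c ∈ L K R (k + 1)) (hd : d ∈ L K R 2) :
    c * d - d * c ∈ L K R (k + 3) := by
  rw [L] at hd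
  induction hd using Submodule.span_induction with
  | mem d hd =>
    obtain ⟨a, b, -, rfl⟩ := hd
    have h1 := commutator_mem_L b (commutator_mem_L a hc)
    have h2 := commutator_mem_L a (commutator_mem_L b hc)
    convert Submodule.sub_mem _ h1 h2 using 1
    noncomm_ring
  | zero => simp
  | add x y _ _ hx hy =>
    convert Submodule.add_mem _ hx hy using 1
    noncomm_ring
  | smul t x _ hx =>
    convert Submodule.smul_mem _ t hx using 1
    simp [smul_sub]

theorem mul_mem_of_adjoin_eq_top {s : Set R} (hs : Algebra.adjoin K s = ⊤) {G : Submodule K R}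
    (h : ∀ v ∈ s, ∀ z ∈ G, v * z ∈ G) (a : R) : ∀ z ∈ G, a * z ∈ G := by
  have ha : a ∈ Algebra.adjoin K s := hs ▸ Algebra.mem_top
  induction ha using Algebra.adjoin_induction with
  | mem v hv => exact h v hv
  | algebraMap t =>
    intro z hz
    rw [← Algebra.smul_def]
    exact G.smul_mem t hz
  | add a b _ _ ha hb =>
    intro z hz
    rw [add_mul]
    exact G.add_mem (ha z hz) (hb z hz)
  | mul a b _ _ ha hb =>
    intro z hz
    rw [mul_assoc]
    exact ha _ (hb z hz)

/-- The Leibniz rule `[ab, z] = a [b, z] + [a, z] b` reduces membership in a two-sided ideal to the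
case of generators. -/
theorem commutator_mem_of_adjoin_eq_top {s : Set R} (hs : Algebra.adjoin K s = ⊤)
    {Z G : Submodule K R} (hl : ∀ a, ∀ z ∈ G, a * z ∈ G) (hr : ∀ z ∈ G, ∀ a, z * a ∈ G)
    (h : ∀ v ∈ s, ∀ z ∈ Z, v * z - z * v ∈ G) (a : R) : ∀ z ∈ Z, a * z - z * a ∈ G := by
  have ha : a ∈ Algebra.adjoin K s := hs ▸ Algebra.mem_top
  induction ha using Algebra.adjoin_induction with
  | mem v hv => exact h v hv
  | algebraMap t =>
    intro z _
    rw [Algebra.commutes, sub_self]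
    exact G.zero_mem
  | add a b _ _ ha hb =>
    intro z hz
    convert G.add_mem (ha z hz) (hb z hz) using 1
    noncomm_ring
  | mul a b _ _ ha hb =>
    intro z hz
    convert G.add_mem (hl a _ (hb z hz)) (hr _ (ha z hz) b) using 1
    noncomm_ring

end General

/-! ### Symmetrization of polynomials in the free algebra. -/

section Symmetrization

open MvPolynomial

variable (K : Type*) [Field K] (n : ℕ)

/-- The span of the generators of the free algebra. -/
def gens : Submodule K (FreeAlgebra K (Fin n)) :=
  Submodule.span K (Set.range (FreeAlgebra.ι K))

/-- The symmetrization map from polynomials to the free algebra, in degree `d`. -/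
noncomputable def symD : ℕ → MvPolynomial (Fin n) K →ₗ[K] FreeAlgebra K (Fin n)
  | 0 => Algebra.linearMap K _ ∘ₗ lcoeff K 0
  | d + 1 => ((d : K) + 1)⁻¹ •
      ∑ i, LinearMap.mulLeft K (FreeAlgebra.ι K i) ∘ₗ symD d ∘ₗ (pderiv i).toLinearMap

variable {K n}

theorem symD_zero (f : MvPolynomial (Fin n) K) : symD K n 0 f = algebraMap K _ (coeff 0 f) := rfl

theorem symD_succ (d : ℕ) (f : MvPolynomial (Fin n) K) :
    symD K n (d + 1) f
      = ((d : K) + 1)⁻¹ • ∑ i, FreeAlgebra.ι K i * symD K n d (pderiv i f) := by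
  simp [symD]

theorem ι_mul_mem_gens_pow {d : ℕ} (i : Fin n) {u : FreeAlgebra K (Fin n)} (hu : u ∈ gens K n ^ d) :
    FreeAlgebra.ι K i * u ∈ gens K n ^ (d + 1) := by
  rw [pow_succ']
  exact Submodule.mul_mem_mul (Submodule.subset_span ⟨i, rfl⟩) hu

theorem symD_mem (d : ℕ) (f : MvPolynomial (Fin n) K) : symD K n d f ∈ gens K n ^ d := by
  induction d generalizing f with
  | zero =>
    rw [symD_zero, pow_zero]
    exact Submodule.algebraMap_mem _
  | succ d ih =>
    rw [symD_succ]
    exact Submodule.smul_mem _ _ (Submodule.sum_mem _ fun i _ => ι_mul_mem_gens_pow i (ih _))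

theorem gens_pow_succ_induction {d : ℕ} {T : Submodule K (FreeAlgebra K (Fin n))}
    (h : ∀ i, ∀ u ∈ gens K n ^ d, FreeAlgebra.ι K i * u ∈ T) : gens K n ^ (d + 1) ≤ T := by
  rw [pow_succ', Submodule.mul_le]
  intro v hv u hu
  unfold gens at hv
  induction hv using Submodule.span_induction with
  | mem v hv =>
    obtain ⟨i, rfl⟩ := hv
    exact h i u hu
  | zero => simp
  | add a b _ _ ha hb =>
    rw [add_mul]
    exact T.add_mem ha hb
  | smul t a _ ha =>
    rw [smul_mul_assoc]
    exact T.smul_mem t ha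

theorem iSup_gens_pow : ⨆ d, gens K n ^ d = ⊤ := by
  have key : ∀ u : FreeAlgebra K (Fin n), ∀ z ∈ ⨆ d, gens K n ^ d, u * z ∈ ⨆ d, gens K n ^ d := by
    intro u
    refine mul_mem_of_adjoin_eq_top (FreeAlgebra.adjoin_range_ι K (Fin n)) ?_ u
    rintro _ ⟨i, rfl⟩ z hz
    induction hz using Submodule.iSup_induction' with
    | mem d z hz => exact Submodule.mem_iSup_of_mem (d + 1) (ι_mul_mem_gens_pow i hz)
    | zero => simp
    | add a b _ _ ha hb =>
      rw [mul_add]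
      exact Submodule.add_mem _ ha hb
  rw [eq_top_iff]
  intro u _
  rw [← mul_one u]
  refine key u 1 (Submodule.mem_iSup_of_mem 0 ?_)
  rw [pow_zero]
  exact Submodule.one_le.1 le_rfl

theorem isHomogeneous_lift_X {d : ℕ} {u : FreeAlgebra K (Fin n)} (hu : u ∈ gens K n ^ d) :
    (FreeAlgebra.lift K (X (R := K)) u).IsHomogeneous d := by
  induction d generalizing u with
  | zero =>
    rw [pow_zero, Submodule.mem_one] at hu
    obtain ⟨t, rfl⟩ := hu
    rw [AlgHom.commutes]
    exact isHomogeneous_C _ _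
  | succ d ih =>
    have : gens K n ^ (d + 1) ≤
        (homogeneousSubmodule (Fin n) K (d + 1)).comap (FreeAlgebra.lift K (X (R := K))).toLinearMap := by
      refine gens_pow_succ_induction fun i u hu => ?_
      simpa [add_comm] using (isHomogeneous_X K i).mul (ih hu)
    exact this hu

section CharZero

variable [CharZero K]

theorem succ_smul_symD_succ (d : ℕ) (f : MvPolynomial (Fin n) K) :
    ((d : K) + 1) • symD K n (d + 1) f = ∑ i, FreeAlgebra.ι K i * symD K n d (pderiv i f) := by
  rw [symD_succ, smul_smul, mul_inv_cancel₀ (Nat.cast_add_one_ne_zero d), one_smul]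

/-- In a commutative target the recursion defining `symD` becomes Euler's formula `∑ xᵢ ∂ᵢ f = (deg
f) f`. -/
theorem algHom_symD {B : Type*} [CommRing B] [Algebra K B] (φ : FreeAlgebra K (Fin n) →ₐ[K] B)
    {d : ℕ} {f : MvPolynomial (Fin n) K} (hf : f.IsHomogeneous d) :
    φ (symD K n d f) = aeval (fun i => φ (FreeAlgebra.ι K i)) f := by
  induction d generalizing f with
  | zero =>
    obtain ⟨c, rfl⟩ : ∃ c, f = C c := ⟨_, (totalDegree_eq_zero_iff_eq_C.1 (Nat.le_zero.1 hf.totalDegree_le))⟩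
    simp [symD_zero]
  | succ d ih =>
    have h0 : ((d : K) + 1) ≠ 0 := Nat.cast_add_one_ne_zero d
    have h := congrArg φ (succ_smul_symD_succ d f)
    rw [map_smul, map_sum] at h
    have h2 := congrArg (aeval (fun i => φ (FreeAlgebra.ι K i))) hf.sum_X_mul_pderiv
    rw [map_sum] at h2
    have h3 : ((d : K) + 1) • φ (symD K n (d + 1) f)
        = ((d : K) + 1) • aeval (fun i => φ (FreeAlgebra.ι K i)) f := by
      rw [h]
      trans aeval (fun i => φ (FreeAlgebra.ι K i)) ((d + 1) • f)
      · rw [← h2]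
        refine Finset.sum_congr rfl fun i _ => ?_
        rw [map_mul, map_mul, aeval_X, ih (by simpa using hf.pderiv (i := i))]
      · rw [map_nsmul, ← Nat.cast_smul_eq_nsmul K]
        push_cast
        rfl
    exact smul_right_injective _ h0 h3

variable {Z : ℕ → Submodule K (FreeAlgebra K (Fin n))}

/-- The family `Z` collects the errors of reordering: it is stable under left multiplication by
generators and contains every word that starts with a commutator of two generators. It is used for
the preimage of `M_2` and for `reorderDefect`. -/
theorem ι_mul_symD_sub_mem
    (hι : ∀ k i, ∀ z ∈ Z k, FreeAlgebra.ι K i * z ∈ Z (k + 1))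
    (hc : ∀ k i j, ∀ u ∈ gens K n ^ k, (FreeAlgebra.ι K i * FreeAlgebra.ι K j
      - FreeAlgebra.ι K j * FreeAlgebra.ι K i) * u ∈ Z (k + 2))
    (i : Fin n) {d : ℕ} {f : MvPolynomial (Fin n) K} (hf : f.IsHomogeneous d) :
    FreeAlgebra.ι K i * symD K n d f - symD K n (d + 1) (X i * f) ∈ Z (d + 1) := by
  have expand : ∀ (d : ℕ) (f : MvPolynomial (Fin n) K),
      ((d : K) + 1) • symD K n (d + 1) (X i * f) = FreeAlgebra.ι K i * symD K n d f
        + ∑ j, FreeAlgebra.ι K j * symD K n d (X i * pderiv j f) := by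
    intro d f
    rw [succ_smul_symD_succ]
    have : ∀ j, symD K n d (pderiv j (X i * f))
        = symD K n d (X i * pderiv j f) + if i = j then symD K n d f else 0 := by
      intro j
      rw [Derivation.leibniz, map_add, smul_eq_mul, smul_eq_mul, pderiv_X]
      by_cases h : i = j
      · subst h; simp
      · simp [h]
    simp_rw [this, mul_add, Finset.sum_add_distrib, mul_ite, mul_zero]
    rw [add_comm]
    simp
  induction d generalizing f with
  | zero =>
    obtain ⟨c, rfl⟩ : ∃ c, f = C c := ⟨_, (totalDegree_eq_zero_iff_eq_C.1 (Nat.le_zero.1 hf.totalDegree_le))⟩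
    have := expand 0 (C c)
    simp only [pderiv_C, mul_zero, map_zero, Finset.sum_const_zero, add_zero, Nat.cast_zero,
      zero_add, one_smul] at this
    rw [zero_add, this, sub_self]
    exact Submodule.zero_mem _
  | succ d ih =>
    have h0 : (((d + 1 : ℕ) : K) + 1) ≠ 0 := Nat.cast_add_one_ne_zero _
    rw [← Submodule.smul_mem_iff _ h0, smul_sub, expand (d + 1) f]
    have h1 : FreeAlgebra.ι K i * (((d : K) + 1) • symD K n (d + 1) f)
        = ∑ j, FreeAlgebra.ι K i * (FreeAlgebra.ι K j * symD K n d (pderiv j f)) := by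
      rw [succ_smul_symD_succ, Finset.mul_sum]
    -- Expanding `symD` of `f` by Euler's formula and swapping `xᵢ` with each leading `xⱼ` leaves
    -- the same defect for `∂ⱼ f`, of smaller degree, plus a word starting with `[xᵢ, xⱼ]`.
    have h2 : (((d + 1 : ℕ) : K) + 1) • (FreeAlgebra.ι K i * symD K n (d + 1) f)
        - (FreeAlgebra.ι K i * symD K n (d + 1) f
          + ∑ j, FreeAlgebra.ι K j * symD K n (d + 1) (X i * pderiv j f))
        = ∑ j, (FreeAlgebra.ι K j * (FreeAlgebra.ι K i * symD K n d (pderiv j f)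
            - symD K n (d + 1) (X i * pderiv j f))
          + (FreeAlgebra.ι K i * FreeAlgebra.ι K j - FreeAlgebra.ι K j * FreeAlgebra.ι K i)
            * symD K n d (pderiv j f)) := by
      have h3 : ∀ j, FreeAlgebra.ι K j * (FreeAlgebra.ι K i * symD K n d (pderiv j f)
            - symD K n (d + 1) (X i * pderiv j f))
          + (FreeAlgebra.ι K i * FreeAlgebra.ι K j - FreeAlgebra.ι K j * FreeAlgebra.ι K i)
            * symD K n d (pderiv j f)
          = FreeAlgebra.ι K i * (FreeAlgebra.ι K j * symD K n d (pderiv j f))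
            - FreeAlgebra.ι K j * symD K n (d + 1) (X i * pderiv j f) := fun j => by noncomm_ring
      simp_rw [h3, Finset.sum_sub_distrib]
      rw [← h1, mul_smul_comm]
      push_cast
      module
    rw [h2]
    refine Submodule.sum_mem _ fun j _ => Submodule.add_mem _ ?_ ?_
    · exact hι _ _ _ (ih (by simpa using hf.pderiv (i := j)))
    · exact hc d i j _ (symD_mem _ _)

/-- Modulo `Z`, an element of word length `d` is the symmetrization of its commutative image. -/
theorem sub_symD_lift_X_mem
    (hι : ∀ k i, ∀ z ∈ Z k, FreeAlgebra.ι K i * z ∈ Z (k + 1))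
    (hc : ∀ k i j, ∀ u ∈ gens K n ^ k, (FreeAlgebra.ι K i * FreeAlgebra.ι K j
      - FreeAlgebra.ι K j * FreeAlgebra.ι K i) * u ∈ Z (k + 2))
    {d : ℕ} {u : FreeAlgebra K (Fin n)} (hu : u ∈ gens K n ^ d) :
    u - symD K n d (FreeAlgebra.lift K (X (R := K)) u) ∈ Z d := by
  induction d generalizing u with
  | zero =>
    rw [pow_zero, Submodule.mem_one] at hu
    obtain ⟨t, rfl⟩ := hu
    rw [AlgHom.commutes, symD_zero, MvPolynomial.algebraMap_eq, coeff_zero_C, sub_self]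
    exact Submodule.zero_mem _
  | succ d ih =>
    have : gens K n ^ (d + 1) ≤ (Z (d + 1)).comap
        (LinearMap.id - symD K n (d + 1) ∘ₗ (FreeAlgebra.lift K (X (R := K))).toLinearMap) := by
      refine gens_pow_succ_induction fun i u hu => ?_
      have h1 := hι _ i _ (ih hu)
      have h2 := ι_mul_symD_sub_mem hι hc i (isHomogeneous_lift_X hu)
      have h3 := Submodule.add_mem _ h1 h2
      rw [mul_sub, sub_add_sub_cancel] at h3
      simpa using h3
    exact this hu

end CharZero

/-- The chain rule; it makes the recursive definition of `symD` compatible with linear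
substitutions. -/
theorem pderiv_polyAction (g : Matrix.GeneralLinearGroup (Fin n) K) (i : Fin n)
    (f : MvPolynomial (Fin n) K) :
    pderiv i (polyAction K n g f) = ∑ j, (g i j : K) • polyAction K n g (pderiv j f) := by
  have hX : ∀ k, polyAction K n g (X k) = ∑ l, (g l k : K) • X l := fun k => by simp [polyAction]
  induction f using MvPolynomial.induction_on with
  | C c =>
    have : polyAction K n g (C c) = C c := AlgHom.commutes _ c
    simp [this]
  | add p q hp hq => simp only [map_add, hp, hq, smul_add, Finset.sum_add_distrib]
  | mul_X p k hp =>
    have h1 : pderiv i (polyAction K n g (X k)) = C (g i k : K) := by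
      rw [hX]
      simp [pderiv_X, Pi.single_apply, smul_eq_C_mul]
    rw [map_mul, Derivation.leibniz, h1, hp]
    simp only [Derivation.leibniz, map_add, smul_eq_mul, map_mul, smul_add, Finset.sum_add_distrib,
      pderiv_X]
    rw [add_comm (polyAction K n g p * _)]
    rw [Finset.mul_sum, add_comm]
    congr 1
    · rw [Finset.sum_eq_single k]
      · simp [smul_eq_C_mul, mul_comm]
      · intro b _ hb
        simp [hb.symm]
      · simp
    · exact Finset.sum_congr rfl fun j _ => (mul_smul_comm _ _ _)

theorem coeff_zero_polyAction (g : Matrix.GeneralLinearGroup (Fin n) K)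
    (f : MvPolynomial (Fin n) K) : coeff 0 (polyAction K n g f) = coeff 0 f := by
  simp only [← constantCoeff_eq]
  have : (constantCoeff.comp (polyAction K n g : MvPolynomial (Fin n) K →+* MvPolynomial (Fin n) K))
      = (constantCoeff : MvPolynomial (Fin n) K →+* K) := by
    ext i
    · simp [polyAction]
    · simp [polyAction, smul_eq_C_mul]
  exact RingHom.congr_fun this f

theorem freeAction_symD (g : Matrix.GeneralLinearGroup (Fin n) K) (d : ℕ)
    (f : MvPolynomial (Fin n) K) :
    freeAction K n g (symD K n d f) = symD K n d (polyAction K n g f) := by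
  induction d generalizing f with
  | zero => rw [symD_zero, symD_zero, coeff_zero_polyAction, AlgHom.commutes]
  | succ d ih =>
    have hι : ∀ j, freeAction K n g (FreeAlgebra.ι K j) = ∑ i, (g i j : K) • FreeAlgebra.ι K i :=
      fun j => by simp [freeAction]
    rw [symD_succ, symD_succ, map_smul, map_sum]
    congr 1
    simp only [pderiv_polyAction, map_sum, map_smul, Finset.mul_sum, map_mul, ih, hι,
      Finset.sum_mul, smul_mul_assoc, mul_smul_comm]
    exact Finset.sum_comm

end Symmetrization

/-! ### Spanning elements for the ideals `M_i` when `M_2 M_3 = 0`. -/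

section Spanning

open MvPolynomial

variable {K R : Type*} [Field K] [Ring R] [Algebra K R]

/-- The images of words in the generators act by iterated commutators with the generators. -/
noncomputable def adRep {n : ℕ} (φ : FreeAlgebra K (Fin n) →ₐ[K] R) :
    FreeAlgebra K (Fin n) →ₐ[K] Module.End K R :=
  FreeAlgebra.lift K fun i =>
    LinearMap.mulLeft K (φ (FreeAlgebra.ι K i)) - LinearMap.mulRight K (φ (FreeAlgebra.ι K i))

/-- The commutator of the two generators. -/
noncomputable def genComm (φ : FreeAlgebra K (Fin 2) →ₐ[K] R) : R :=
  φ (FreeAlgebra.ι K 0) * φ (FreeAlgebra.ι K 1) - φ (FreeAlgebra.ι K 1) * φ (FreeAlgebra.ι K 0)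

/-- Iterated commutators of the generators applied to the commutator of the two generators. -/
noncomputable def adComm (φ : FreeAlgebra K (Fin 2) →ₐ[K] R) : FreeAlgebra K (Fin 2) →ₗ[K] R :=
  LinearMap.applyₗ (genComm φ) ∘ₗ (adRep φ).toLinearMap

theorem adRep_ι {n : ℕ} (φ : FreeAlgebra K (Fin n) →ₐ[K] R) (i : Fin n) (z : R) :
    adRep φ (FreeAlgebra.ι K i) z
      = φ (FreeAlgebra.ι K i) * z - z * φ (FreeAlgebra.ι K i) := by
  simp [adRep]

theorem adRep_mem_L {n : ℕ} (φ : FreeAlgebra K (Fin n) →ₐ[K] R) {k : ℕ}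
    (u : FreeAlgebra K (Fin n)) : ∀ z ∈ L K R (k + 1), adRep φ u z ∈ L K R (k + 1) := by
  induction u using FreeAlgebra.induction with
  | grade0 t =>
    intro z hz
    rw [AlgHom.commutes, Module.algebraMap_end_apply]
    exact Submodule.smul_mem _ _ hz
  | grade1 i =>
    intro z hz
    rw [adRep_ι]
    exact L_succ_le _ (commutator_mem_L _ hz)
  | mul a b ha hb =>
    intro z hz
    rw [map_mul]
    exact ha _ (hb z hz)
  | add a b ha hb =>
    intro z hz
    rw [map_add]
    exact Submodule.add_mem _ (ha z hz) (hb z hz)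

theorem adRep_mem_L_of_mem_gens_pow_mul {n : ℕ} (φ : FreeAlgebra K (Fin n) →ₐ[K] R) {k m : ℕ}
    {u : FreeAlgebra K (Fin n)} (hu : u ∈ gens K n ^ k * ⊤) {z : R} (hz : z ∈ L K R (m + 1)) :
    adRep φ u z ∈ L K R (m + k + 1) := by
  induction k generalizing u with
  | zero => exact adRep_mem_L φ u z hz
  | succ k ih =>
    rw [pow_succ', mul_assoc] at hu
    have key : gens K n * (gens K n ^ k * ⊤)
        ≤ (L K R (m + (k + 1) + 1)).comap (LinearMap.applyₗ z ∘ₗ (adRep φ).toLinearMap) := by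
      rw [Submodule.mul_le]
      intro v hv u hu
      unfold gens at hv
      induction hv using Submodule.span_induction with
      | mem v hv =>
        obtain ⟨i, rfl⟩ := hv
        have := commutator_mem_L (φ (FreeAlgebra.ι K i)) (ih hu)
        simpa [adRep_ι, ← add_assoc] using this
      | zero => simp
      | add a b _ _ ha hb =>
        rw [add_mul]
        exact Submodule.add_mem _ ha hb
      | smul t a _ ha =>
        rw [smul_mul_assoc]
        exact Submodule.smul_mem _ t ha
    exact key hu

variable (φ : FreeAlgebra K (Fin 2) →ₐ[K] R)

theorem genComm_mem : genComm φ ∈ L K R 2 :=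
  commutator_mem_L _ Submodule.mem_top

theorem adComm_mul (u v : FreeAlgebra K (Fin 2)) :
    adComm φ (u * v) = adRep φ u (adComm φ v) := by
  simp [adComm]

theorem adComm_ι_mul (i : Fin 2) (u : FreeAlgebra K (Fin 2)) :
    adComm φ (FreeAlgebra.ι K i * u)
      = φ (FreeAlgebra.ι K i) * adComm φ u - adComm φ u * φ (FreeAlgebra.ι K i) := by
  rw [adComm_mul, adRep_ι]

theorem adComm_algebraMap (t : K) : adComm φ (algebraMap K _ t) = t • genComm φ := by
  simp [adComm, Module.algebraMap_end_apply]

/-- The span of the iterated commutators of length at least `k + 2`. -/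
noncomputable def adTail (k : ℕ) : Submodule K R := (gens K 2 ^ k * ⊤).map (adComm φ)

/-- The right ideal generated by the iterated commutators of length at least `k + 2`. -/
noncomputable def adIdeal (k : ℕ) : Submodule K R := adTail φ k * ⊤

/-- The right ideal generated by the products of an iterated commutator of length at least
`k + 2` and the commutator of the generators. -/
noncomputable def adCommIdeal (k : ℕ) : Submodule K R :=
  (adTail φ k).map (LinearMap.mulRight K (genComm φ)) * ⊤

variable {φ}

theorem adTail_le_L (k : ℕ) : adTail φ k ≤ L K R (k + 2) := by
  rintro _ ⟨u, hu, rfl⟩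
  have := adRep_mem_L_of_mem_gens_pow_mul φ hu (m := 1) (genComm_mem φ)
  rwa [add_comm 1 k, add_assoc] at this

theorem adTail_succ_le (k : ℕ) : adTail φ (k + 1) ≤ adTail φ k := by
  refine Submodule.map_mono ?_
  rw [pow_succ, mul_assoc]
  exact mul_le_mul' le_rfl le_top

theorem commutator_mem_adTail {k : ℕ} (i : Fin 2) {z : R} (hz : z ∈ adTail φ k) :
    φ (FreeAlgebra.ι K i) * z - z * φ (FreeAlgebra.ι K i) ∈ adTail φ (k + 1) := by
  obtain ⟨u, hu, rfl⟩ := hz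
  rw [← adComm_ι_mul]
  refine Submodule.mem_map_of_mem ?_
  rw [pow_succ', mul_assoc]
  exact Submodule.mul_mem_mul (Submodule.subset_span ⟨i, rfl⟩) hu

theorem mul_mem_adIdeal {k : ℕ} {z : R} (hz : z ∈ adTail φ k) (a : R) : z * a ∈ adIdeal φ k :=
  Submodule.mul_mem_mul hz Submodule.mem_top

theorem mul_mem_adCommIdeal {k : ℕ} {z : R} (hz : z ∈ adTail φ k) (a : R) :
    z * genComm φ * a ∈ adCommIdeal φ k :=
  Submodule.mul_mem_mul ⟨z, hz, rfl⟩ Submodule.mem_top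

theorem adIdeal_le {k : ℕ} {T : Submodule K R} (h : ∀ z ∈ adTail φ k, ∀ a, z * a ∈ T) :
    adIdeal φ k ≤ T :=
  Submodule.mul_le.2 fun z hz a _ => h z hz a

theorem adCommIdeal_le {k : ℕ} {T : Submodule K R}
    (h : ∀ z ∈ adTail φ k, ∀ a, z * genComm φ * a ∈ T) : adCommIdeal φ k ≤ T := by
  refine Submodule.mul_le.2 ?_
  rintro _ ⟨z, hz, rfl⟩ a _
  exact h z hz a

theorem mul_right_mem_of_eq_mul_top {B G : Submodule K R} (hG : G = B * ⊤) :
    ∀ z ∈ G, ∀ a, z * a ∈ G := by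
  intro z hz a
  have : G * ⊤ ≤ G := by
    rw [hG, mul_assoc]
    exact mul_le_mul' le_rfl le_top
  exact this (Submodule.mul_mem_mul hz Submodule.mem_top)

theorem commutator_mem_M_two (a b : R) : a * b - b * a ∈ M K R 2 :=
  L_le_M 2 (commutator_mem_L a Submodule.mem_top)

theorem genComm_mul_self_mem : genComm φ * genComm φ ∈ M K R 3 := by
  set x := φ (FreeAlgebra.ι K 0)
  set y := φ (FreeAlgebra.ι K 1)
  -- Since `[xy, y] = w y`, one gets `[x, [xy, y]] = [x, w] y + w²`.
  have h1 : x * (x * y * y - y * (x * y)) - (x * y * y - y * (x * y)) * x ∈ L K R 3 :=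
    commutator_mem_L x (commutator_mem_L (x * y) Submodule.mem_top)
  have h2 : (x * genComm φ - genComm φ * x) * y ∈ M K R 3 :=
    mul_mem_M_right (L_le_M 3 (commutator_mem_L x (genComm_mem φ))) y
  convert Submodule.sub_mem _ (L_le_M 3 h1) h2 using 1
  change (x * y - y * x) * (x * y - y * x) = _ - (x * (x * y - y * x) - (x * y - y * x) * x) * y
  noncomm_ring

section Relation

variable (hφ : Function.Surjective φ) (h23 : ∀ a ∈ M K R 2, ∀ b ∈ M K R 3, a * b = 0)

include hφ

theorem adjoin_range_eq_top :
    Algebra.adjoin K (Set.range fun i => φ (FreeAlgebra.ι K i)) = ⊤ := by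
  have h := AlgHom.map_adjoin φ (Set.range (FreeAlgebra.ι K (X := Fin 2)))
  rw [FreeAlgebra.adjoin_range_ι, ← Set.range_comp, Algebra.map_top] at h
  exact h.symm.trans ((AlgHom.range_eq_top φ).2 hφ)

/-- The right ideal is two-sided because `v z = z v + [v, z]`, and `[v, z]` is again an iterated
commutator, one step longer. -/
theorem mul_left_mem_adIdeal (k : ℕ) (a : R) : ∀ z ∈ adIdeal φ k, a * z ∈ adIdeal φ k := by
  refine mul_mem_of_adjoin_eq_top (adjoin_range_eq_top hφ) ?_ a
  rintro _ ⟨i, rfl⟩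
  change adIdeal φ k ≤ (adIdeal φ k).comap (LinearMap.mulLeft K (φ (FreeAlgebra.ι K i)))
  refine adIdeal_le fun z hz a => ?_
  have h1 := mul_mem_adIdeal hz (φ (FreeAlgebra.ι K i) * a)
  have h2 := mul_mem_adIdeal (adTail_succ_le k (commutator_mem_adTail i hz)) a
  have h3 := Submodule.add_mem _ h1 h2
  simp only [Submodule.mem_comap, LinearMap.mulLeft_apply]
  convert h3 using 1
  noncomm_ring

theorem M_two_le_adIdeal : M K R 2 ≤ adIdeal φ 0 := by
  have hl := mul_left_mem_adIdeal (φ := φ) hφ 0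
  have hr := mul_right_mem_of_eq_mul_top (G := adIdeal φ 0) rfl
  have hw : genComm φ ∈ adIdeal φ 0 := by
    have := mul_mem_adIdeal (φ := φ) (k := 0)
      (Submodule.mem_map_of_mem (f := adComm φ) (r := algebraMap K _ 1) (by simp)) 1
    rwa [adComm_algebraMap, one_smul, mul_one] at this
  refine M_le_of_L_le hl hr ?_
  rw [L, Submodule.span_le]
  rintro _ ⟨a, b, -, rfl⟩
  have h1 : ∀ i j, φ (FreeAlgebra.ι K i) * φ (FreeAlgebra.ι K j)
      - φ (FreeAlgebra.ι K j) * φ (FreeAlgebra.ι K i) ∈ adIdeal φ 0 := by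
    intro i j
    fin_cases i <;> fin_cases j
    · simp
    · exact hw
    · rw [← neg_sub]
      exact Submodule.neg_mem _ hw
    · simp
  have h2 : ∀ i a, a * φ (FreeAlgebra.ι K i) - φ (FreeAlgebra.ι K i) * a ∈ adIdeal φ 0 := by
    intro i a
    refine commutator_mem_of_adjoin_eq_top (adjoin_range_eq_top hφ) hl hr
      (Z := Submodule.span K {φ (FreeAlgebra.ι K i)}) ?_ a _ (Submodule.mem_span_singleton_self _)
    rintro _ ⟨j, rfl⟩ z hz
    obtain ⟨t, rfl⟩ := Submodule.mem_span_singleton.1 hz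
    rw [mul_smul_comm, smul_mul_assoc, ← smul_sub]
    exact Submodule.smul_mem _ _ (h1 _ _)
  refine commutator_mem_of_adjoin_eq_top (adjoin_range_eq_top hφ) hl hr (Z := ⊤) ?_ a b
    Submodule.mem_top
  rintro _ ⟨j, rfl⟩ z _
  rw [← neg_sub]
  exact Submodule.neg_mem _ (h2 j z)

/-- Every iterated commutator is a scalar multiple of `w` modulo `L_3`, so only `w R` survives
modulo `M_3`. -/
theorem exists_sub_genComm_mul_mem {c : R} (hc : c ∈ M K R 2) :
    ∃ u, c - genComm φ * u ∈ M K R 3 := by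
  have hX : ∀ u : FreeAlgebra K (Fin 2), ∀ z ∈ Submodule.span K {genComm φ} ⊔ L K R 3,
      adRep φ u z ∈ Submodule.span K {genComm φ} ⊔ L K R 3 := by
    intro u
    induction u using FreeAlgebra.induction with
    | grade0 t =>
      intro z hz
      rw [AlgHom.commutes, Module.algebraMap_end_apply]
      exact Submodule.smul_mem _ _ hz
    | grade1 i =>
      intro z hz
      have hz2 : z ∈ L K R 2 := by
        refine (sup_le ?_ (L_succ_le 2)) hz
        rw [Submodule.span_singleton_le_iff_mem]
        exact genComm_mem φ
      rw [adRep_ι]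
      exact Submodule.mem_sup_right (commutator_mem_L _ hz2)
    | mul a b ha hb =>
      intro z hz
      rw [map_mul]
      exact ha _ (hb z hz)
    | add a b ha hb =>
      intro z hz
      rw [map_add]
      exact Submodule.add_mem _ (ha z hz) (hb z hz)
  have key : adIdeal φ 0 ≤ (⊤ : Submodule K R).map (LinearMap.mulLeft K (genComm φ)) ⊔ M K R 3 := by
    refine adIdeal_le ?_
    rintro _ ⟨u, -, rfl⟩ a
    have h := hX u (genComm φ) (Submodule.mem_sup_left (Submodule.mem_span_singleton_self _))
    obtain ⟨y, hy, l, hl, h⟩ := Submodule.mem_sup.1 h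
    obtain ⟨t, rfl⟩ := Submodule.mem_span_singleton.1 hy
    change adRep φ u (genComm φ) * a ∈ _
    rw [← h, add_mul]
    refine Submodule.add_mem_sup ⟨t • a, Submodule.mem_top, ?_⟩ (mul_mem_M_right (L_le_M 3 hl) a)
    simp
  obtain ⟨y, ⟨u, -, rfl⟩, l, hl, h⟩ := Submodule.mem_sup.1 (key (M_two_le_adIdeal hφ hc))
  refine ⟨u, ?_⟩
  rw [← h]
  simpa using hl

/-- Modulo `M_3` the product is `w u w v = w² u v + w [u, w] v`, and both terms lie in `M_3`. -/
theorem M_two_mul_M_two {a b : R} (ha : a ∈ M K R 2) (hb : b ∈ M K R 2) : a * b ∈ M K R 3 := by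
  obtain ⟨u, hu⟩ := exists_sub_genComm_mul_mem hφ ha
  obtain ⟨v, hv⟩ := exists_sub_genComm_mul_mem hφ hb
  have h1 : genComm φ * genComm φ * u * v ∈ M K R 3 :=
    mul_mem_M_right (mul_mem_M_right genComm_mul_self_mem u) v
  have h2 := mul_mem_M_left (genComm φ)
    (mul_mem_M_right (L_le_M 3 (commutator_mem_L u (genComm_mem φ))) v)
  have h3 := mul_mem_M_right hu (genComm φ * v)
  have h4 := mul_mem_M_left a hv
  convert Submodule.add_mem _ (Submodule.add_mem _ h1 h2) (Submodule.add_mem _ h3 h4) using 1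
  noncomm_ring

include h23

theorem mul_mul_eq_zero {a b c : R} (ha : a ∈ M K R 2) (hb : b ∈ M K R 2) (hc : c ∈ M K R 2) :
    a * b * c = 0 := by
  rw [mul_assoc]
  exact h23 a ha _ (M_two_mul_M_two hφ hb hc)

theorem exists_mul_eq_mul_genComm_mul {c : R} (hc : c ∈ M K R 2) :
    ∃ u, ∀ a ∈ M K R 2, a * c = a * genComm φ * u := by
  obtain ⟨u, hu⟩ := exists_sub_genComm_mul_mem hφ hc
  refine ⟨u, fun a ha => ?_⟩
  rw [mul_assoc, ← sub_eq_zero, ← mul_sub]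
  exact h23 a ha _ hu

omit hφ in
theorem mul_mul_genComm {a : R} (ha : a ∈ M K R 2) (v : R) :
    a * v * genComm φ = a * genComm φ * v := by
  have := h23 a ha _ (L_le_M 3 (commutator_mem_L v (genComm_mem φ)))
  rwa [mul_sub, sub_eq_zero, ← mul_assoc, ← mul_assoc] at this

omit hφ h23 in
theorem adTail_le_M_two (k : ℕ) : adTail φ k ≤ M K R 2 := by
  induction k with
  | zero => exact (adTail_le_L 0).trans (L_le_M 2)
  | succ k ih => exact (adTail_succ_le k).trans ih

theorem mul_left_mem_adCommIdeal (k : ℕ) (a : R) :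
    ∀ z ∈ adCommIdeal φ k, a * z ∈ adCommIdeal φ k := by
  refine mul_mem_of_adjoin_eq_top (adjoin_range_eq_top hφ) ?_ a
  rintro _ ⟨i, rfl⟩
  change adCommIdeal φ k ≤ (adCommIdeal φ k).comap (LinearMap.mulLeft K (φ (FreeAlgebra.ι K i)))
  refine adCommIdeal_le fun z hz a => ?_
  have h1 := mul_mem_adCommIdeal hz (φ (FreeAlgebra.ι K i) * a)
  have h2 := mul_mem_adCommIdeal (adTail_succ_le k (commutator_mem_adTail i hz)) a
  have h3 := Submodule.add_mem _ h1 h2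
  have h4 := mul_mul_genComm (φ := φ) h23 (adTail_le_M_two k hz) (φ (FreeAlgebra.ι K i))
  simp only [Submodule.mem_comap, LinearMap.mulLeft_apply]
  convert h3 using 1
  rw [sub_mul, sub_mul, h4]
  noncomm_ring

/-- In `[v, z a] = [v, z] a + z [v, a]` the first term is a longer commutator and the second has the
form `z w u`. -/
theorem commutator_mem_of_mem_adIdeal {k : ℕ} (i : Fin 2) {z : R} (hz : z ∈ adIdeal φ k) :
    φ (FreeAlgebra.ι K i) * z - z * φ (FreeAlgebra.ι K i)
      ∈ adIdeal φ (k + 1) ⊔ adCommIdeal φ k := by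
  set v := φ (FreeAlgebra.ι K i) with hv
  have key : adIdeal φ k ≤ (adIdeal φ (k + 1) ⊔ adCommIdeal φ k).comap
      (LinearMap.mulLeft K v - LinearMap.mulRight K v) := by
    refine adIdeal_le fun z hz a => ?_
    obtain ⟨u, hu⟩ := exists_mul_eq_mul_genComm_mul hφ h23 (commutator_mem_M_two (K := K) v a)
    have h1 := mul_mem_adIdeal (commutator_mem_adTail i hz) a
    have h2 := mul_mem_adCommIdeal hz u
    rw [← hu z (adTail_le_M_two k hz)] at h2
    change v * (z * a) - z * a * v ∈ adIdeal φ (k + 1) ⊔ adCommIdeal φ k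
    convert Submodule.add_mem_sup h1 h2 using 1
    noncomm_ring
  exact key hz

/-- Of the three Leibniz terms of `[v, z w a]` only `[v, z] w a` survives: `z [v, w] a` vanishes by
`M_2 M_3 = 0` and `z w [v, a]` by `M_2³ = 0`. -/
theorem commutator_mem_of_mem_adCommIdeal {k : ℕ} (i : Fin 2) {z : R} (hz : z ∈ adCommIdeal φ k) :
    φ (FreeAlgebra.ι K i) * z - z * φ (FreeAlgebra.ι K i) ∈ adCommIdeal φ (k + 1) := by
  set v := φ (FreeAlgebra.ι K i) with hv
  have key : adCommIdeal φ k ≤ (adCommIdeal φ (k + 1)).comap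
      (LinearMap.mulLeft K v - LinearMap.mulRight K v) := by
    refine adCommIdeal_le fun z hz a => ?_
    have hz2 := adTail_le_M_two k hz
    have h1 := mul_mem_adCommIdeal (commutator_mem_adTail i hz) a
    have h2 := mul_mul_genComm (φ := φ) h23 hz2 v
    have h3 := mul_mul_eq_zero hφ h23 hz2 (L_le_M 2 (genComm_mem φ))
      (commutator_mem_M_two (K := K) v a)
    change v * (z * genComm φ * a) - z * genComm φ * a * v ∈ adCommIdeal φ (k + 1)
    convert h1 using 1
    rw [sub_mul, sub_mul, h2]
    rw [mul_sub, sub_eq_zero] at h3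
    simp only [mul_assoc] at h3 ⊢
    rw [h3]
  exact key hz

theorem L_le_adIdeal_sup (k : ℕ) : L K R (k + 3) ≤ adIdeal φ (k + 1) ⊔ adCommIdeal φ k := by
  have hl : ∀ k l a, ∀ z ∈ adIdeal φ k ⊔ adCommIdeal φ l, a * z ∈ adIdeal φ k ⊔ adCommIdeal φ l := by
    intro k l a z hz
    obtain ⟨p, hp, q, hq, rfl⟩ := Submodule.mem_sup.1 hz
    rw [mul_add]
    exact Submodule.add_mem_sup (mul_left_mem_adIdeal hφ k a p hp)
      (mul_left_mem_adCommIdeal hφ h23 l a q hq)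
  have hr : ∀ k l, ∀ z ∈ adIdeal φ k ⊔ adCommIdeal φ l, ∀ a, z * a ∈ adIdeal φ k ⊔ adCommIdeal φ l :=
    fun k l => mul_right_mem_of_eq_mul_top (by rw [Submodule.sup_mul]; rfl)
  induction k with
  | zero =>
    rw [L, Submodule.span_le]
    rintro _ ⟨a, b, hb, rfl⟩
    refine commutator_mem_of_adjoin_eq_top (adjoin_range_eq_top hφ) (hl _ _) (hr _ _)
      (Z := adIdeal φ 0) ?_ a b (M_two_le_adIdeal hφ (L_le_M 2 hb))
    rintro _ ⟨i, rfl⟩ z hz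
    exact commutator_mem_of_mem_adIdeal hφ h23 i hz
  | succ k ih =>
    rw [L, Submodule.span_le]
    rintro _ ⟨a, b, hb, rfl⟩
    refine commutator_mem_of_adjoin_eq_top (adjoin_range_eq_top hφ) (hl _ _) (hr _ _)
      (Z := adIdeal φ (k + 1) ⊔ adCommIdeal φ k) ?_ a b (ih hb)
    rintro _ ⟨i, rfl⟩ z hz
    obtain ⟨p, hp, q, hq, rfl⟩ := Submodule.mem_sup.1 hz
    convert Submodule.add_mem _ (commutator_mem_of_mem_adIdeal hφ h23 i hp)
      (Submodule.mem_sup_right (commutator_mem_of_mem_adCommIdeal hφ h23 i hq)) using 1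
    noncomm_ring

theorem M_le_adIdeal_sup (k : ℕ) : M K R (k + 3) ≤ adIdeal φ (k + 1) ⊔ adCommIdeal φ k := by
  refine M_le_of_L_le (fun a z hz => ?_)
    (mul_right_mem_of_eq_mul_top (by rw [Submodule.sup_mul]; rfl)) (L_le_adIdeal_sup hφ h23 k)
  obtain ⟨p, hp, q, hq, rfl⟩ := Submodule.mem_sup.1 hz
  rw [mul_add]
  exact Submodule.add_mem_sup (mul_left_mem_adIdeal hφ _ a p hp)
    (mul_left_mem_adCommIdeal hφ h23 _ a q hq)

omit hφ h23 in
theorem adIdeal_le_M (k : ℕ) : adIdeal φ k ≤ M K R (k + 2) :=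
  adIdeal_le fun _ hz a => mul_mem_M_right (L_le_M _ (adTail_le_L k hz)) a

omit hφ in
theorem genComm_mul_eq_zero {z : R} (hz : z ∈ M K R 3) : genComm φ * z = 0 :=
  h23 _ (L_le_M 2 (genComm_mem φ)) z hz

omit hφ h23 in
theorem adTail_succ_le_M_three (k : ℕ) : adTail φ (k + 1) ≤ M K R 3 := by
  induction k with
  | zero => exact (adTail_le_L 1).trans (L_le_M 3)
  | succ k ih => exact (adTail_succ_le _).trans ih

omit hφ in
-- Here `z ∈ M_3`, so `w z = 0` and `z w = [z, w]`, to which `commutator_L_two_mem` applies.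
theorem adCommIdeal_le_M (k : ℕ) : adCommIdeal φ (k + 1) ≤ M K R (k + 5) := by
  refine adCommIdeal_le fun z hz a => mul_mem_M_right ?_ a
  have h := commutator_L_two_mem (adTail_le_L (k + 1) hz) (genComm_mem φ)
  rw [genComm_mul_eq_zero h23 (adTail_succ_le_M_three k hz), sub_zero] at h
  exact L_le_M _ h

omit h23 hφ in
theorem gens_pow_mul_top_le (n k : ℕ) :
    gens K n ^ k * ⊤ ≤ gens K n ^ k ⊔ gens K n ^ (k + 1) * ⊤ := by
  rw [Submodule.mul_le]
  intro a ha b hb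
  clear hb
  have hb : b ∈ ⨆ d, gens K n ^ d := by
    rw [iSup_gens_pow]
    exact Submodule.mem_top
  induction hb using Submodule.iSup_induction' with
  | mem d b hb =>
    cases d with
    | zero =>
      rw [pow_zero, Submodule.mem_one] at hb
      obtain ⟨t, rfl⟩ := hb
      rw [← Algebra.commutes, ← Algebra.smul_def]
      exact Submodule.mem_sup_left (Submodule.smul_mem _ _ ha)
    | succ d =>
      refine Submodule.mem_sup_right ?_
      have h : gens K n ^ k * gens K n ^ (d + 1) ≤ gens K n ^ (k + 1) * ⊤ := by
        rw [pow_succ' _ d, ← mul_assoc, ← pow_succ]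
        exact mul_le_mul' le_rfl le_top
      exact h (Submodule.mul_mem_mul ha hb)
  | zero => simp
  | add a b _ _ ha hb =>
    rw [mul_add]
    exact Submodule.add_mem _ ha hb

omit hφ h23 in
theorem adComm_comm_mul (u : FreeAlgebra K (Fin 2)) :
    adComm φ ((FreeAlgebra.ι K 0 * FreeAlgebra.ι K 1 - FreeAlgebra.ι K 1 * FreeAlgebra.ι K 0) * u)
      = genComm φ * adComm φ u - adComm φ u * genComm φ := by
  rw [sub_mul, map_sub, mul_assoc, mul_assoc]
  simp only [adComm_ι_mul, genComm]
  noncomm_ring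

/-- The words of length `k` that give, through iterated commutators, a multiple of the commutator of
the generators by iterated commutators of smaller length. -/
noncomputable def reorderDefect (φ : FreeAlgebra K (Fin 2) →ₐ[K] R) :
    ℕ → Submodule K (FreeAlgebra K (Fin 2))
  | 0 => ⊥
  | 1 => ⊥
  | k + 2 => (((gens K 2 ^ k).map (adComm φ)).map (LinearMap.mulRight K (genComm φ))).comap (adComm φ)

omit hφ in
theorem ι_mul_mem_reorderDefect (k : ℕ) (i : Fin 2) :
    ∀ z ∈ reorderDefect φ k, FreeAlgebra.ι K i * z ∈ reorderDefect φ (k + 1) := by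
  intro z hz
  match k with
  | 0 =>
    rw [reorderDefect, Submodule.mem_bot] at hz
    rw [hz, mul_zero]
    exact Submodule.zero_mem _
  | 1 =>
    rw [reorderDefect, Submodule.mem_bot] at hz
    rw [hz, mul_zero]
    exact Submodule.zero_mem _
  | k + 2 =>
    obtain ⟨_, ⟨u, hu, rfl⟩, hz⟩ := hz
    refine ⟨_, ⟨FreeAlgebra.ι K i * u, ι_mul_mem_gens_pow i hu, rfl⟩, ?_⟩
    rw [adComm_ι_mul, adComm_ι_mul, ← hz]
    have hu2 : adComm φ u ∈ M K R 2 := adTail_le_M_two 0 ⟨u, by simp, rfl⟩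
    have h := mul_mul_genComm (φ := φ) h23 hu2 (φ (FreeAlgebra.ι K i))
    simp only [LinearMap.mulRight_apply, sub_mul]
    rw [h]
    noncomm_ring

omit hφ in
-- The word `[x₁, x₂] u` acts on `w` by `[w, ad u (w)]`. This is `[w, w] = 0` up to a scalar if `u`
-- has length 0, and `-ad u (w) w` otherwise, since then `w · ad u (w) = 0`.
theorem comm_mul_mem_reorderDefect (k : ℕ) (i j : Fin 2) :
    ∀ u ∈ gens K 2 ^ k, (FreeAlgebra.ι K i * FreeAlgebra.ι K j
      - FreeAlgebra.ι K j * FreeAlgebra.ι K i) * u ∈ reorderDefect φ (k + 2) := by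
  intro u hu
  have key : (FreeAlgebra.ι K 0 * FreeAlgebra.ι K 1 - FreeAlgebra.ι K 1 * FreeAlgebra.ι K 0) * u
      ∈ reorderDefect φ (k + 2) := by
    rw [reorderDefect, Submodule.mem_comap, adComm_comm_mul]
    cases k with
    | zero =>
      rw [pow_zero, Submodule.mem_one] at hu
      obtain ⟨t, rfl⟩ := hu
      simp [adComm_algebraMap]
    | succ k =>
      have hu3 : adComm φ u ∈ M K R 3 := by
        refine adTail_succ_le_M_three k ⟨u, ?_, rfl⟩
        rw [← mul_one u]
        exact Submodule.mul_mem_mul hu Submodule.mem_top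
      rw [genComm_mul_eq_zero h23 hu3, zero_sub]
      exact Submodule.neg_mem _ ⟨_, ⟨u, hu, rfl⟩, rfl⟩
  fin_cases i <;> fin_cases j
  · simp
  · exact key
  · rw [← neg_sub, neg_mul]
    exact Submodule.neg_mem _ key
  · simp

variable [CharZero K]

omit h23 in
theorem exists_symD_sub_mem (a : R) :
    a ∈ Submodule.span K {z | ∃ (i : ℕ) (q : MvPolynomial (Fin 2) K), q.IsHomogeneous i ∧
      z = φ (symD K 2 i q)} ⊔ M K R 2 := by
  obtain ⟨a, rfl⟩ := hφ a
  have ha : a ∈ ⨆ d, gens K 2 ^ d := by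
    rw [iSup_gens_pow]
    exact Submodule.mem_top
  induction ha using Submodule.iSup_induction' with
  | mem d a ha =>
    have h := sub_symD_lift_X_mem (Z := fun _ => (M K R 2).comap φ.toLinearMap)
      (fun k i z hz => by
        have := mul_mem_M_left (φ (FreeAlgebra.ι K i)) hz
        simpa using this)
      (fun k i j u _ => by
        have := mul_mem_M_right (commutator_mem_M_two (K := K) (φ (FreeAlgebra.ι K i))
          (φ (FreeAlgebra.ι K j))) (φ u)
        simpa using this) ha
    simp only [Submodule.mem_comap, AlgHom.toLinearMap_apply, map_sub] at h
    have h2 : φ (symD K 2 d (FreeAlgebra.lift K (X (R := K)) a)) ∈ Submodule.span K {z |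
        ∃ (i : ℕ) (q : MvPolynomial (Fin 2) K), q.IsHomogeneous i ∧ z = φ (symD K 2 i q)} :=
      Submodule.subset_span ⟨d, _, isHomogeneous_lift_X ha, rfl⟩
    have h3 := Submodule.add_mem_sup h2 h
    rwa [add_sub_cancel] at h3
  | zero => simp
  | add a b _ _ ha hb =>
    rw [map_add]
    exact Submodule.add_mem _ ha hb

/-- Modulo `M_{m+6}`, the ideal `M_{m+5}` is spanned by symmetrized iterated commutators and their
products with the commutator of the generators, multiplied from the right by symmetrized
polynomials. -/
theorem M_le_of_symD_mem {m : ℕ} {T : Submodule K R} (hT : M K R (m + 6) ≤ T)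
    (h1 : ∀ (f : MvPolynomial (Fin 2) K), f.IsHomogeneous (m + 3) → ∀ (i : ℕ)
      (q : MvPolynomial (Fin 2) K), q.IsHomogeneous i →
      adComm φ (symD K 2 (m + 3) f) * φ (symD K 2 i q) ∈ T)
    (h2 : ∀ (f : MvPolynomial (Fin 2) K), f.IsHomogeneous (m + 1) → ∀ (i : ℕ)
      (q : MvPolynomial (Fin 2) K), q.IsHomogeneous i →
      adComm φ (symD K 2 (m + 1) f) * genComm φ * φ (symD K 2 i q) ∈ T) :
    M K R (m + 5) ≤ T := by
  have tail : ∀ {k : ℕ} {u : FreeAlgebra K (Fin 2)}, u ∈ gens K 2 ^ k → adComm φ u ∈ adTail φ k := by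
    intro k u hu
    refine ⟨u, ?_, rfl⟩
    rw [← mul_one u]
    exact Submodule.mul_mem_mul hu Submodule.mem_top
  -- The second family with one letter more than required already lies in `M_{m+6}`.
  have hB : ∀ k, m + 2 ≤ k → adCommIdeal φ k ≤ T := by
    intro k hk
    obtain ⟨l, rfl⟩ := Nat.exists_eq_add_of_le hk
    refine le_trans ?_ ((adCommIdeal_le_M (φ := φ) h23 (m + 1)).trans hT)
    clear hk
    induction l with
    | zero => exact le_rfl
    | succ l ih => exact (mul_le_mul' (Submodule.map_mono (adTail_succ_le _)) le_rfl).trans ih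
  -- Symmetrized polynomials together with `M_2` span `R`, so right factors can be tested on these
  -- two kinds.
  have right : ∀ z : R, (∀ (i : ℕ) (q : MvPolynomial (Fin 2) K), q.IsHomogeneous i →
      z * φ (symD K 2 i q) ∈ T) → (∀ c ∈ M K R 2, z * c ∈ T) → ∀ a, z * a ∈ T := by
    intro z hz hc a
    have key : Submodule.span K {z | ∃ (i : ℕ) (q : MvPolynomial (Fin 2) K), q.IsHomogeneous i ∧
        z = φ (symD K 2 i q)} ⊔ M K R 2 ≤ T.comap (LinearMap.mulLeft K z) := by
      refine sup_le (Submodule.span_le.2 ?_) hc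
      rintro _ ⟨i, q, hq, rfl⟩
      exact hz i q hq
    exact key (exists_symD_sub_mem hφ a)
  have second : ∀ u ∈ gens K 2 ^ (m + 1), ∀ a, adComm φ u * genComm φ * a ∈ T := by
    intro u hu a
    have hz := sub_symD_lift_X_mem (ι_mul_mem_reorderDefect (φ := φ) h23)
      (comm_mul_mem_reorderDefect h23) hu
    have hf := isHomogeneous_lift_X hu
    set f := FreeAlgebra.lift K (X (R := K)) u
    -- The reordering error is a multiple `ad v (w) w`, and one further factor `w` kills it by `M_2³
    -- = 0`.
    have h0 : adComm φ u * genComm φ = adComm φ (symD K 2 (m + 1) f) * genComm φ := by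
      rw [← sub_eq_zero, ← sub_mul, ← map_sub]
      cases m with
      | zero =>
        rw [reorderDefect, Submodule.mem_bot] at hz
        rw [hz, map_zero, zero_mul]
      | succ m =>
        obtain ⟨_, ⟨v, hv, rfl⟩, hz⟩ := hz
        rw [← hz]
        exact mul_mul_eq_zero hφ h23 (adTail_le_M_two _ (tail hv)) (L_le_M 2 (genComm_mem φ))
          (L_le_M 2 (genComm_mem φ))
    rw [h0]
    refine right _ (h2 f hf) (fun c hc => ?_) a
    rw [mul_mul_eq_zero hφ h23 (adTail_le_M_two _ (tail (symD_mem _ f)))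
      (L_le_M 2 (genComm_mem φ)) hc]
    exact T.zero_mem
  have first : ∀ u ∈ gens K 2 ^ (m + 3), ∀ a, adComm φ u * a ∈ T := by
    intro u hu a
    have hz := sub_symD_lift_X_mem (ι_mul_mem_reorderDefect (φ := φ) h23)
      (comm_mul_mem_reorderDefect h23) hu
    have hf := isHomogeneous_lift_X hu
    set f := FreeAlgebra.lift K (X (R := K)) u
    -- Here the reordering error is `ad v (w) w` with `v` two letters shorter, of length `m + 1`:
    -- exactly what `second` covers.
    obtain ⟨_, ⟨v, hv, rfl⟩, hz⟩ := hz
    have h3 := second v hv a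
    have h4 : adComm φ (symD K 2 (m + 3) f) * a ∈ T := by
      refine right _ (h1 f hf) (fun c hc => ?_) a
      obtain ⟨y, hy⟩ := exists_mul_eq_mul_genComm_mul hφ h23 hc
      rw [hy _ (adTail_le_M_two _ (tail (symD_mem _ f)))]
      exact hB (m + 3) (by omega) (mul_mem_adCommIdeal (tail (symD_mem _ f)) y)
    rw [LinearMap.mulRight_apply, map_sub] at hz
    rw [hz, sub_mul] at h3
    simpa using T.add_mem h3 h4
  refine (M_le_adIdeal_sup hφ h23 (m + 2)).trans (sup_le ?_ (hB _ le_rfl))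
  -- Only words of length exactly `m + 3` matter; longer ones give elements of `M_{m+6}`.
  have h5 : adTail φ (m + 3) ≤ (gens K 2 ^ (m + 3)).map (adComm φ) ⊔ adTail φ (m + 4) := by
    unfold adTail
    rw [← Submodule.map_sup]
    exact Submodule.map_mono (gens_pow_mul_top_le 2 _)
  refine adIdeal_le fun z hz a => ?_
  obtain ⟨_, ⟨u, hu, rfl⟩, y, hy, rfl⟩ := Submodule.mem_sup.1 (h5 hz)
  rw [add_mul]
  exact T.add_mem (first u hu a) (hT (adIdeal_le_M _ (mul_mem_adIdeal hy a)))

end Relation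

end Spanning

/-! ### Triangular matrices and the filtration of the first row. -/

section Triangular

variable {K R P : Type*} [Field K] [Ring R] [Algebra K R] [CommRing P] [Algebra K P]

/-- Upper triangular matrices with diagonal `(a, b, b, b)` where `a - b ∈ I`. -/
structure IsTri (I : Ideal P) (m : Matrix (Fin 4) (Fin 4) P) : Prop where
  zero10 : m 1 0 = 0
  zero20 : m 2 0 = 0
  zero21 : m 2 1 = 0
  zero30 : m 3 0 = 0
  zero31 : m 3 1 = 0
  zero32 : m 3 2 = 0
  eq22 : m 2 2 = m 1 1
  eq33 : m 3 3 = m 1 1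
  sub_mem : m 0 0 - m 1 1 ∈ I

theorem mul_apply_four (m n : Matrix (Fin 4) (Fin 4) P) (i j : Fin 4) :
    (m * n) i j = m i 0 * n 0 j + m i 1 * n 1 j + m i 2 * n 2 j + m i 3 * n 3 j := by
  rw [Matrix.mul_apply, Fin.sum_univ_four]

variable {I : Ideal P}

theorem IsTri.add {m n : Matrix (Fin 4) (Fin 4) P} (hm : IsTri I m) (hn : IsTri I n) :
    IsTri I (m + n) := by
  have h := I.add_mem hm.sub_mem hn.sub_mem
  constructor
  case sub_mem =>
    convert h using 1
    simp only [Matrix.add_apply]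
    ring
  all_goals simp [hm.zero10, hm.zero20, hm.zero21, hm.zero30, hm.zero31, hm.zero32, hm.eq22,
    hm.eq33, hn.zero10, hn.zero20, hn.zero21, hn.zero30, hn.zero31, hn.zero32, hn.eq22, hn.eq33]

theorem IsTri.mul {m n : Matrix (Fin 4) (Fin 4) P} (hm : IsTri I m) (hn : IsTri I n) :
    IsTri I (m * n) := by
  have h := I.add_mem (I.mul_mem_left (n 0 0) hm.sub_mem) (I.mul_mem_left (m 1 1) hn.sub_mem)
  constructor
  case sub_mem =>
    convert h using 1
    simp only [mul_apply_four, hm.zero10, hn.zero10, hn.zero20, hn.zero21, hn.zero30, hn.zero31]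
    ring
  all_goals simp [mul_apply_four, hm.zero10, hm.zero20, hm.zero21, hm.zero30, hm.zero31, hm.zero32,
    hm.eq22, hm.eq33, hn.zero10, hn.zero20, hn.zero21, hn.zero30, hn.zero31, hn.zero32, hn.eq22,
    hn.eq33]

theorem IsTri.algebraMap (t : K) :
    IsTri I (algebraMap K (Matrix (Fin 4) (Fin 4) P) t) := by
  constructor <;> simp [Matrix.algebraMap_matrix_apply]

/-- Strictly upper triangular matrices with vanishing entries `(1, 2)` and `(2, 3)` whose
`(0, 1)` entry lies in `I`. -/
def stepTwo (K : Type*) [Field K] [Algebra K P] (I : Ideal P) :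
    Submodule K (Matrix (Fin 4) (Fin 4) P) where
  carrier := {m | (∀ i, m i 0 = 0) ∧ m 0 1 ∈ I ∧ m 1 1 = 0 ∧ m 2 1 = 0 ∧ m 3 1 = 0 ∧
    (∀ i, i ≠ 0 → m i 2 = 0) ∧ m 2 3 = 0 ∧ m 3 3 = 0}
  zero_mem' := by simp
  add_mem' := by
    rintro a b ⟨a1, a2, a3, a4, a5, a6, a7, a8⟩ ⟨b1, b2, b3, b4, b5, b6, b7, b8⟩
    refine ⟨fun i => by simp [a1, b1], I.add_mem a2 b2, by simp [a3, b3], by simp [a4, b4],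
      by simp [a5, b5], fun i hi => by simp [a6 i hi, b6 i hi], by simp [a7, b7], by simp [a8, b8]⟩
  smul_mem' := by
    rintro t a ⟨a1, a2, a3, a4, a5, a6, a7, a8⟩
    refine ⟨fun i => by simp [a1], ?_, by simp [a3], by simp [a4],
      by simp [a5], fun i hi => by simp [a6 i hi], by simp [a7], by simp [a8]⟩
    rw [Matrix.smul_apply, Algebra.smul_def]
    exact I.mul_mem_left _ a2

/-- Matrices supported in the entries `(0, 1)`, `(0, 2)` and `(0, 3)`, which lie in the powers
`j + 2`, `j + 1` and `j` of the ideal `I`. -/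
def rowFiltration (K : Type*) [Field K] [Algebra K P] (I : Ideal P) (j : ℕ) :
    Submodule K (Matrix (Fin 4) (Fin 4) P) where
  carrier := {m | (∀ i k, i ≠ 0 → m i k = 0) ∧ m 0 0 = 0 ∧ m 0 1 ∈ I ^ (j + 2) ∧
    m 0 2 ∈ I ^ (j + 1) ∧ m 0 3 ∈ I ^ j}
  zero_mem' := by simp
  add_mem' := by
    rintro a b ⟨a1, a2, a3, a4, a5⟩ ⟨b1, b2, b3, b4, b5⟩
    exact ⟨fun i k hi => by simp [a1 i k hi, b1 i k hi], by simp [a2, b2], Ideal.add_mem _ a3 b3,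
      Ideal.add_mem _ a4 b4, Ideal.add_mem _ a5 b5⟩
  smul_mem' := by
    rintro t a ⟨a1, a2, a3, a4, a5⟩
    refine ⟨fun i k hi => by simp [a1 i k hi], by simp [a2], ?_, ?_, ?_⟩ <;>
      rw [Matrix.smul_apply, Algebra.smul_def]
    exacts [Ideal.mul_mem_left _ _ a3, Ideal.mul_mem_left _ _ a4, Ideal.mul_mem_left _ _ a5]

variable (ψ : R →ₐ[K] Matrix (Fin 4) (Fin 4) P) (hψ : ∀ a, IsTri I (ψ a))

include hψ

theorem map_M_two_mem {c : R} (hc : c ∈ M K R 2) : ψ c ∈ stepTwo K I := by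
  have key : M K R 2 ≤ (stepTwo K I).comap ψ.toLinearMap := by
    refine M_le_of_L_le (fun a z hz => ?_) (fun z hz a => ?_) ?_
    · obtain ⟨b1, b2, b3, b4, b5, b6, b7, b8⟩ := hz
      have ha := hψ a
      change ψ (a * z) ∈ stepTwo K I
      rw [map_mul]
      simp only [AlgHom.toLinearMap_apply] at *
      refine ⟨fun i => ?_, ?_, ?_, ?_, ?_, fun i hi => ?_, ?_, ?_⟩
      · simp [mul_apply_four, b1]
      · simpa [mul_apply_four, b3, b4, b5] using I.mul_mem_left _ b2
      · simp [mul_apply_four, ha.zero10, b3, b4, b5]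
      · simp [mul_apply_four, ha.zero20, b3, b4, b5]
      · simp [mul_apply_four, ha.zero30, b3, b4, b5]
      · have : ψ a i 0 = 0 := by
          fin_cases i
          exacts [absurd rfl hi, ha.zero10, ha.zero20, ha.zero30]
        simp [mul_apply_four, this, b6 1, b6 2, b6 3]
      · simp [mul_apply_four, ha.zero20, ha.zero21, b7, b8]
      · simp [mul_apply_four, ha.zero30, ha.zero31, b7, b8]
    · obtain ⟨b1, b2, b3, b4, b5, b6, b7, b8⟩ := hz
      have ha := hψ a
      change ψ (z * a) ∈ stepTwo K I
      rw [map_mul]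
      simp only [AlgHom.toLinearMap_apply] at *
      refine ⟨fun i => ?_, ?_, ?_, ?_, ?_, fun i hi => ?_, ?_, ?_⟩
      · simp [mul_apply_four, b1, ha.zero10, ha.zero20, ha.zero30]
      · simpa [mul_apply_four, b1, ha.zero21, ha.zero31] using I.mul_mem_right _ b2
      · simp [mul_apply_four, b1, b3, ha.zero21, ha.zero31]
      · simp [mul_apply_four, b1, b4, ha.zero21, ha.zero31]
      · simp [mul_apply_four, b1, b5, ha.zero21, ha.zero31]
      · have : ψ z i 1 = 0 := by
          fin_cases i
          exacts [absurd rfl hi, b3, b4, b5]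
        simp [mul_apply_four, b1, this, b6 i hi, ha.zero32]
      · simp [mul_apply_four, b1, b4, b6 2, b7]
      · simp [mul_apply_four, b1, b5, b6 3, b8]
    · rw [L, Submodule.span_le]
      rintro _ ⟨a, b, -, rfl⟩
      have ha := hψ a
      have hb := hψ b
      change ψ (a * b - b * a) ∈ stepTwo K I
      rw [map_sub, map_mul, map_mul]
      refine ⟨fun i => ?_, ?_, ?_, ?_, ?_, fun i hi => ?_, ?_, ?_⟩
      · fin_cases i <;> simp [mul_apply_four, ha.zero10, hb.zero10, ha.zero20, hb.zero20, ha.zero30,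
          hb.zero30, mul_comm]
      · convert I.sub_mem (I.mul_mem_left (ψ b 0 1) ha.sub_mem)
          (I.mul_mem_left (ψ a 0 1) hb.sub_mem) using 1
        simp only [Matrix.sub_apply, mul_apply_four, ha.zero21, hb.zero21, ha.zero31, hb.zero31]
        ring
      · simp [mul_apply_four, ha.zero10, hb.zero10, ha.zero21, hb.zero21, ha.zero31, hb.zero31,
          mul_comm]
      · simp [mul_apply_four, ha.zero20, hb.zero20, ha.zero21, hb.zero21, ha.zero31, hb.zero31]
      · simp [mul_apply_four, ha.zero30, hb.zero30, ha.zero21, hb.zero21, ha.zero31, hb.zero31]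
      · fin_cases i
        · exact absurd rfl hi
        · simp [mul_apply_four, ha.zero10, hb.zero10, ha.zero32, hb.zero32, ha.eq22, hb.eq22]
          ring
        · simp [mul_apply_four, ha.zero20, hb.zero20, ha.zero21, hb.zero21, ha.zero32, hb.zero32,
            mul_comm]
        · simp [mul_apply_four, ha.zero30, hb.zero30, ha.zero31, hb.zero31, ha.zero32, hb.zero32]
      · simp [mul_apply_four, ha.zero20, hb.zero20, ha.zero21, hb.zero21, ha.eq22, hb.eq22, ha.eq33,
          hb.eq33]
        ring
      · simp [mul_apply_four, ha.zero30, hb.zero30, ha.zero31, hb.zero31, ha.zero32, hb.zero32,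
          mul_comm]
  exact key hc

/-- Bracketing a first-row matrix `b` with `a` multiplies its entries by `a₀₀ - a₁₁ ∈ I`, up to
corrections coming from entries further left. Those lie in higher powers of `I`, which is why the
exponents decrease along the row. -/
theorem map_M_mem_rowFiltration (j : ℕ) {c : R} (hc : c ∈ M K R (j + 3)) :
    ψ c ∈ rowFiltration K I j := by
  have left : ∀ j a, ∀ z ∈ (rowFiltration K I j).comap ψ.toLinearMap,
      a * z ∈ (rowFiltration K I j).comap ψ.toLinearMap := by
    rintro j a z ⟨b1, b2, b3, b4, b5⟩
    have ha := hψ a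
    change ψ (a * z) ∈ rowFiltration K I j
    rw [map_mul]
    simp only [AlgHom.toLinearMap_apply] at *
    refine ⟨fun i k hi => ?_, ?_, ?_, ?_, ?_⟩
    · have : ψ a i 0 = 0 := by
        fin_cases i
        exacts [absurd rfl hi, ha.zero10, ha.zero20, ha.zero30]
      simp [mul_apply_four, this, b1 1, b1 2, b1 3]
    · simp [mul_apply_four, b2, b1 1, b1 2, b1 3]
    · simpa [mul_apply_four, b1 1, b1 2, b1 3] using Ideal.mul_mem_left _ _ b3
    · simpa [mul_apply_four, b1 1, b1 2, b1 3] using Ideal.mul_mem_left _ _ b4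
    · simpa [mul_apply_four, b1 1, b1 2, b1 3] using Ideal.mul_mem_left _ _ b5
  have right : ∀ j, ∀ z ∈ (rowFiltration K I j).comap ψ.toLinearMap, ∀ a,
      z * a ∈ (rowFiltration K I j).comap ψ.toLinearMap := by
    rintro j z ⟨b1, b2, b3, b4, b5⟩ a
    have ha := hψ a
    change ψ (z * a) ∈ rowFiltration K I j
    rw [map_mul]
    simp only [AlgHom.toLinearMap_apply] at *
    have c3 : ψ z 0 1 ∈ I ^ (j + 1) := Ideal.pow_le_pow_right (by omega) b3
    have c4 : ψ z 0 1 ∈ I ^ j := Ideal.pow_le_pow_right (by omega) b3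
    have c5 : ψ z 0 2 ∈ I ^ j := Ideal.pow_le_pow_right (by omega) b4
    refine ⟨fun i k hi => ?_, ?_, ?_, ?_, ?_⟩
    · simp [mul_apply_four, b1 i _ hi]
    · simp [mul_apply_four, b2, ha.zero10, ha.zero20, ha.zero30]
    · simpa [mul_apply_four, b2, ha.zero21, ha.zero31] using Ideal.mul_mem_right _ _ b3
    · simpa [mul_apply_four, b2, ha.zero32] using
        Ideal.add_mem _ (Ideal.mul_mem_right _ _ c3) (Ideal.mul_mem_right _ _ b4)
    · simpa [mul_apply_four, b2] using Ideal.add_mem _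
        (Ideal.add_mem _ (Ideal.mul_mem_right _ _ c4) (Ideal.mul_mem_right _ _ c5))
        (Ideal.mul_mem_right _ _ b5)
  have key : L K R (j + 3) ≤ (rowFiltration K I j).comap ψ.toLinearMap := by
    clear hc
    induction j with
    | zero =>
      rw [L, Submodule.span_le]
      rintro _ ⟨a, b, hb, rfl⟩
      have ha := hψ a
      obtain ⟨b1, b2, b3, b4, b5, b6, b7, b8⟩ := map_M_two_mem ψ hψ (L_le_M 2 hb)
      change ψ (a * b - b * a) ∈ rowFiltration K I 0
      rw [map_sub, map_mul, map_mul]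
      refine ⟨fun i k hi => ?_, ?_, ?_, ?_, ?_⟩
      · have h12 := b6 1 (by decide)
        have h22 := b6 2 (by decide)
        have h32 := b6 3 (by decide)
        fin_cases i
        · exact absurd rfl hi
        all_goals fin_cases k <;> simp [mul_apply_four, ha.zero10, ha.zero20, ha.zero21, ha.zero30,
          ha.zero31, ha.zero32, ha.eq22, ha.eq33, b1, b3, b4, b5, h12, h22, h32, b7, b8, mul_comm]
      · simp [mul_apply_four, b1, ha.zero10, ha.zero20, ha.zero30]
      · have := Ideal.mul_mem_mul ha.sub_mem b2
        rw [← pow_two] at this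
        convert this using 1
        simp only [Matrix.sub_apply, mul_apply_four, b1, b3, b4, b5, ha.zero21, ha.zero31]
        ring
      · rw [zero_add, pow_one]
        have h1 := I.mul_mem_right (ψ b 0 2) ha.sub_mem
        have h2 := I.mul_mem_right (ψ a 1 2) b2
        convert I.sub_mem h1 h2 using 1
        simp only [Matrix.sub_apply, mul_apply_four, b1, b6 1 (by decide), b6 2 (by decide),
          b6 3 (by decide), ha.zero32, ha.eq22]
        ring
      · simp
    | succ j ih =>
      rw [L, Submodule.span_le]
      rintro _ ⟨a, b, hb, rfl⟩
      have ha := hψ a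
      obtain ⟨b1, b2, b3, b4, b5⟩ := ih hb
      change ψ (a * b - b * a) ∈ rowFiltration K I (j + 1)
      rw [map_sub, map_mul, map_mul]
      simp only [AlgHom.toLinearMap_apply] at *
      have z1 := fun k => b1 1 k (by decide)
      have z2 := fun k => b1 2 k (by decide)
      have z3 := fun k => b1 3 k (by decide)
      have c3 : ψ b 0 1 ∈ I ^ (j + 1) := Ideal.pow_le_pow_right (by omega) b3
      refine ⟨fun i k hi => ?_, ?_, ?_, ?_, ?_⟩
      · have : ψ a i 0 = 0 := by
          fin_cases i
          exacts [absurd rfl hi, ha.zero10, ha.zero20, ha.zero30]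
        simp [mul_apply_four, this, z1, z2, z3, b1 i _ hi]
      · simp [mul_apply_four, b2, z1, z2, z3, ha.zero10, ha.zero20, ha.zero30]
      · have := Ideal.mul_mem_mul ha.sub_mem b3
        rw [← pow_succ'] at this
        convert this using 1
        simp only [Matrix.sub_apply, mul_apply_four, b2, z1, z2, z3, ha.zero21, ha.zero31]
        ring
      · have h1 := Ideal.mul_mem_mul ha.sub_mem b4
        rw [← pow_succ'] at h1
        convert Ideal.sub_mem _ h1 (Ideal.mul_mem_right (ψ a 1 2) _ b3) using 1
        simp only [Matrix.sub_apply, mul_apply_four, b2, z1, z2, z3, ha.zero32, ha.eq22]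
        ring
      · have h1 := Ideal.mul_mem_mul ha.sub_mem b5
        rw [← pow_succ'] at h1
        convert Ideal.sub_mem _ (Ideal.sub_mem _ h1 (Ideal.mul_mem_right (ψ a 1 3) _ c3))
          (Ideal.mul_mem_right (ψ a 2 3) _ b4) using 1
        simp only [Matrix.sub_apply, mul_apply_four, b2, z1, z2, z3, ha.eq33]
        ring
  exact M_le_of_L_le (left j) (right j) key hc

theorem map_mul_eq_zero {b c : R} (hb : b ∈ M K R 2) (hc : c ∈ M K R 3) : ψ (b * c) = 0 := by
  obtain ⟨b1, -⟩ := map_M_two_mem ψ hψ hb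
  obtain ⟨c1, -⟩ := map_M_mem_rowFiltration ψ hψ 0 hc
  rw [map_mul]
  ext i k
  simp [mul_apply_four, b1, c1 1, c1 2, c1 3]

theorem map_mul_apply_zero_one {c : R} (hc : c ∈ M K R 2) (a : R) :
    ψ (c * a) 0 1 = ψ c 0 1 * ψ a 1 1 := by
  obtain ⟨b1, -⟩ := map_M_two_mem ψ hψ hc
  rw [map_mul]
  simp [mul_apply_four, b1, (hψ a).zero21, (hψ a).zero31]

theorem map_mul_mul_apply_zero_one {b c : R} (hb : b ∈ M K R 2) (hc : c ∈ M K R 2) (a : R) :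
    ψ (b * c * a) 0 1 = 0 := by
  obtain ⟨b1, -⟩ := map_M_two_mem ψ hψ hb
  obtain ⟨c1, c2, c3, c4, c5, -⟩ := map_M_two_mem ψ hψ hc
  rw [map_mul, map_mul]
  simp [mul_apply_four, b1, c1, c3, c4, c5, (hψ a).zero21, (hψ a).zero31]

theorem map_mul_mul_apply_zero_three {b c : R} (hb : b ∈ M K R 2) (hc : c ∈ M K R 2) (a : R) :
    ψ (b * c * a) 0 3 = ψ b 0 1 * ψ c 1 3 * ψ a 1 1 := by
  obtain ⟨b1, -⟩ := map_M_two_mem ψ hψ hb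
  obtain ⟨c1, c2, c3, c4, c5, c6, c7, c8⟩ := map_M_two_mem ψ hψ hc
  rw [map_mul, map_mul]
  simp [mul_apply_four, b1, c1, c3, c4, c5, c6 1, c6 2, c6 3, c7, c8, (hψ a).eq33]

theorem map_commutator_apply_zero_one (a : R) {c : R} (hc : c ∈ M K R 2) :
    ψ (a * c - c * a) 0 1 = (ψ a 0 0 - ψ a 1 1) * ψ c 0 1 := by
  obtain ⟨c1, c2, c3, c4, c5, -⟩ := map_M_two_mem ψ hψ hc
  rw [map_sub, map_mul, map_mul]
  simp only [Matrix.sub_apply, mul_apply_four, c1, c3, c4, c5, (hψ a).zero21, (hψ a).zero31]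
  ring

/-- On entry (0,1) each bracket with a generator is multiplication by its diagonal difference, so
iterated commutators act there through a commutative algebra. -/
theorem map_adRep_apply_zero_one {n : ℕ} (φ : FreeAlgebra K (Fin n) →ₐ[K] R)
    (u : FreeAlgebra K (Fin n)) : ∀ z ∈ L K R 2, ψ (adRep φ u z) 0 1 =
      FreeAlgebra.lift K (fun i => ψ (φ (FreeAlgebra.ι K i)) 0 0 - ψ (φ (FreeAlgebra.ι K i)) 1 1) u
        * ψ z 0 1 := by
  induction u using FreeAlgebra.induction with
  | grade0 t =>
    intro z _
    rw [AlgHom.commutes, Module.algebraMap_end_apply, map_smul, AlgHom.commutes, Matrix.smul_apply,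
      Algebra.smul_def]
  | grade1 i =>
    intro z hz
    rw [adRep_ι, map_commutator_apply_zero_one ψ hψ _ (L_le_M 2 hz), FreeAlgebra.lift_ι_apply]
  | mul a b ha hb =>
    intro z hz
    rw [map_mul, Module.End.mul_apply, ha _ (adRep_mem_L φ b z hz), hb z hz, map_mul, mul_assoc]
  | add a b ha hb =>
    intro z hz
    rw [map_add, LinearMap.add_apply, map_add, Matrix.add_apply, ha z hz, hb z hz, map_add, add_mul]

theorem map_apply_one_one {n : ℕ} (φ : FreeAlgebra K (Fin n) →ₐ[K] R) (u : FreeAlgebra K (Fin n)) :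
    ψ (φ u) 1 1 = FreeAlgebra.lift K (fun i => ψ (φ (FreeAlgebra.ι K i)) 1 1) u := by
  induction u using FreeAlgebra.induction with
  | grade0 t => simp [Matrix.algebraMap_matrix_apply]
  | grade1 i => simp
  | mul a b ha hb =>
    rw [map_mul, map_mul, map_mul, mul_apply_four, ha, hb]
    simp [(hψ (φ a)).zero10, (hψ (φ b)).zero21, (hψ (φ b)).zero31]
  | add a b ha hb =>
    rw [map_add, map_add, map_add, Matrix.add_apply, ha, hb]

end Triangular

/-! ### The separating matrix representation. -/

section Model

open MvPolynomial

variable (K : Type*) [Field K]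

/-- A representation of the free algebra by triangular matrices over a polynomial ring in four
variables that annihilates `M_2 M_3`. -/
noncomputable def triRep : FreeAlgebra K (Fin 2) →ₐ[K]
    Matrix (Fin 4) (Fin 4) (MvPolynomial (Fin 2) (MvPolynomial (Fin 2) K)) :=
  FreeAlgebra.lift K
    -- The inner variables `C (X i)` record right factors, and the outer variables `X i` are the
    -- diagonal differences that record iterated commutators. The off-diagonal ones give `w` the
    -- entries `X 0` at (0,1) and `1` at (1,3).
    ![!![C (X 0) + X 0, 0, 0, 0; 0, C (X 0), 1, 0; 0, 0, C (X 0), 0; 0, 0, 0, C (X 0)],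
      !![C (X 1) + X 1, 1, 0, 0; 0, C (X 1), 0, 0; 0, 0, C (X 1), 1; 0, 0, 0, C (X 1)]]

theorem isTri_triRep (a : FreeAlgebra K (Fin 2)) :
    IsTri (idealOfVars (Fin 2) (MvPolynomial (Fin 2) K)) (triRep K a) := by
  induction a using FreeAlgebra.induction with
  | grade0 t =>
    rw [AlgHom.commutes]
    exact IsTri.algebraMap t
  | grade1 i =>
    rw [triRep, FreeAlgebra.lift_ι_apply]
    have h : ∀ i, (X i : MvPolynomial (Fin 2) (MvPolynomial (Fin 2) K)) ∈ idealOfVars _ _ :=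
      fun i => Ideal.subset_span ⟨i, rfl⟩
    fin_cases i
    · constructor
      case sub_mem => simpa using h 0
      all_goals simp
    · constructor
      case sub_mem => simpa using h 1
      all_goals simp
  | mul a b ha hb =>
    rw [map_mul]
    exact ha.mul hb
  | add a b ha hb =>
    rw [map_add]
    exact ha.add hb

/-- The representation of `A_2 / (M_2 M_3)` induced by `triRep`. -/
noncomputable def triRepQuot : PIQuot K (FreeAlgebra K (Fin 2)) 2 3 →ₐ[K]
    Matrix (Fin 4) (Fin 4) (MvPolynomial (Fin 2) (MvPolynomial (Fin 2) K)) :=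
  Ideal.Quotient.liftₐ _ (triRep K) fun a ha => by
    have h : M K (FreeAlgebra K (Fin 2)) 2 * M K (FreeAlgebra K (Fin 2)) 3
        ≤ LinearMap.ker (triRep K).toLinearMap :=
      Submodule.mul_le.2 fun b hb c hc => map_mul_eq_zero (triRep K) (isTri_triRep K) hb hc
    exact h ha

/-- The quotient map from `A_2` to `A_2 / (M_2 M_3)`. -/
noncomputable abbrev toPIQuot : FreeAlgebra K (Fin 2) →ₐ[K] PIQuot K (FreeAlgebra K (Fin 2)) 2 3 :=
  Ideal.Quotient.mkₐ K _

theorem triRepQuot_apply (a : FreeAlgebra K (Fin 2)) :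
    triRepQuot K (toPIQuot K a) = triRep K a := rfl

theorem isTri_triRepQuot (a : PIQuot K (FreeAlgebra K (Fin 2)) 2 3) :
    IsTri (idealOfVars (Fin 2) (MvPolynomial (Fin 2) K)) (triRepQuot K a) := by
  obtain ⟨a, rfl⟩ := Ideal.Quotient.mkₐ_surjective K _ a
  exact isTri_triRep K a

theorem triRepQuot_genComm :
    triRepQuot K (genComm (toPIQuot K)) 0 1 = X 0 ∧ triRepQuot K (genComm (toPIQuot K)) 1 3 = 1 := by
  rw [genComm, map_sub, map_mul, map_mul, triRepQuot_apply, triRepQuot_apply]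
  simp only [triRep, FreeAlgebra.lift_ι_apply]
  constructor
  · simp
  · simp

variable [CharZero K]

theorem triRepQuot_adComm_symD {d : ℕ} {f : MvPolynomial (Fin 2) K} (hf : f.IsHomogeneous d) :
    triRepQuot K (adComm (toPIQuot K) (symD K 2 d f)) 0 1
      = map (algebraMap K (MvPolynomial (Fin 2) K)) f * X 0 := by
  change triRepQuot K (adRep _ _ _) 0 1 = _
  rw [map_adRep_apply_zero_one _ (isTri_triRepQuot K) _ _ _ (genComm_mem _), algHom_symD _ hf,
    (triRepQuot_genComm K).1]
  congr 1
  have : (fun i => FreeAlgebra.lift K (fun i =>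
      triRepQuot K (toPIQuot K (FreeAlgebra.ι K i)) 0 0
        - triRepQuot K (toPIQuot K (FreeAlgebra.ι K i)) 1 1) (FreeAlgebra.ι K i))
      = (X : Fin 2 → MvPolynomial (Fin 2) (MvPolynomial (Fin 2) K)) := by
    funext i
    rw [FreeAlgebra.lift_ι_apply, triRepQuot_apply, triRep, FreeAlgebra.lift_ι_apply]
    fin_cases i <;> simp
  rw [this]
  clear hf this
  induction f using MvPolynomial.induction_on with
  | C c => simp [MvPolynomial.algebraMap_apply]
  | add p q hp hq => rw [map_add, map_add, hp, hq]
  | mul_X p i hp => rw [map_mul, map_mul, hp, aeval_X, map_X]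

theorem triRepQuot_symD {d : ℕ} {q : MvPolynomial (Fin 2) K} (hq : q.IsHomogeneous d) :
    triRepQuot K (toPIQuot K (symD K 2 d q)) 1 1 = C q := by
  rw [map_apply_one_one _ (isTri_triRepQuot K), algHom_symD _ hq]
  have : (fun i => FreeAlgebra.lift K (fun i =>
      triRepQuot K (toPIQuot K (FreeAlgebra.ι K i)) 1 1) (FreeAlgebra.ι K i))
      = fun i => (Algebra.ofId (MvPolynomial (Fin 2) K)
          (MvPolynomial (Fin 2) (MvPolynomial (Fin 2) K))).restrictScalars K (X i) := by
    funext i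
    rw [FreeAlgebra.lift_ι_apply, triRepQuot_apply, triRep, FreeAlgebra.lift_ι_apply]
    fin_cases i <;> simp [Algebra.ofId_apply]
  rw [this, ← MvPolynomial.comp_aeval_apply, aeval_X_left_apply]
  rfl

end Model

/-! ### Lifting along surjections, and an injectivity criterion. -/

section Lifting

variable {K R S : Type*} [CommRing K] [Ring R] [Algebra K R] [Ring S] [Algebra K S]

theorem L_le_map_of_surjective (f : R →ₐ[K] S) (hf : Function.Surjective f) :
    ∀ i : ℕ, L K S i ≤ (L K R i).map f.toLinearMap
  | 0 => fun x _ => by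
    obtain ⟨y, rfl⟩ := hf x
    exact ⟨y, Submodule.mem_top, rfl⟩
  | 1 => fun x _ => by
    obtain ⟨y, rfl⟩ := hf x
    exact ⟨y, Submodule.mem_top, rfl⟩
  | i + 2 => by
    conv_lhs => rw [L]
    rw [Submodule.span_le]
    rintro _ ⟨a, b, hb, rfl⟩
    obtain ⟨a, rfl⟩ := hf a
    obtain ⟨b, hb', rfl⟩ := L_le_map_of_surjective f hf (i + 1) hb
    exact ⟨a * b - b * a, commutator_mem_L a hb', by simp⟩

theorem M_le_map_of_surjective (f : R →ₐ[K] S) (hf : Function.Surjective f) (i : ℕ) :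
    M K S i ≤ (M K R i).map f.toLinearMap := by
  have h : (⊤ : Submodule K S) ≤ (⊤ : Submodule K R).map f.toLinearMap :=
    L_le_map_of_surjective f hf 0
  unfold M
  rw [Submodule.map_mul, Submodule.map_mul]
  exact mul_le_mul' (mul_le_mul' h (L_le_map_of_surjective f hf i)) h

theorem mul_mem_mulIdeal {i j : ℕ} {a b : R} (ha : a ∈ M K R i) (hb : b ∈ M K R j) :
    a * b ∈ mulIdeal K R i j :=
  (Submodule.mul_mem_mul ha hb : a * b ∈ M K R i * M K R j)

theorem mul_eq_zero_of_surjective (f : R →ₐ[K] S) (hf : Function.Surjective f) {i j : ℕ}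
    (h : ∀ a ∈ M K R i, ∀ b ∈ M K R j, f (a * b) = 0) :
    ∀ a ∈ M K S i, ∀ b ∈ M K S j, a * b = 0 := by
  intro a ha b hb
  obtain ⟨c, hc, rfl⟩ := M_le_map_of_surjective f hf i ha
  obtain ⟨d, hd, rfl⟩ := M_le_map_of_surjective f hf j hb
  rw [AlgHom.toLinearMap_apply, AlgHom.toLinearMap_apply, ← map_mul]
  exact h c hc d hd

/-- Subtraction comes from the scalar `-1`, so the kernel criterion works with only `AddCommMonoid`
instances. -/
theorem injective_of_map_eq_zero {V W : Type*} [AddCommMonoid V] [Module K V] [AddCommMonoid W]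
    [Module K W] (f : V →ₗ[K] W) (h : ∀ z, f z = 0 → z = 0) : Function.Injective f := by
  let := Module.addCommMonoidToAddCommGroup K (M := V)
  let := Module.addCommMonoidToAddCommGroup K (M := W)
  exact (injective_iff_map_eq_zero f).2 h

end Lifting

/-! ### Equivariance of iterated commutators. -/

section Equivariance

variable {K R : Type*} [Field K] [Ring R] [Algebra K R]

theorem map_adRep_of_comp_eq {n : ℕ} (φ : FreeAlgebra K (Fin n) →ₐ[K] R) (σ : R →ₐ[K] R)
    (g : Matrix.GeneralLinearGroup (Fin n) K) (hσ : ∀ a, σ (φ a) = φ (freeAction K n g a))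
    (u : FreeAlgebra K (Fin n)) :
    ∀ z, σ (adRep φ u z) = adRep φ (freeAction K n g u) (σ z) := by
  have hι : ∀ j, freeAction K n g (FreeAlgebra.ι K j) = ∑ i, (g i j : K) • FreeAlgebra.ι K i :=
    fun j => by simp [freeAction]
  induction u using FreeAlgebra.induction with
  | grade0 t =>
    intro z
    simp only [AlgHom.commutes, Module.algebraMap_end_apply, map_smul]
  | grade1 i =>
    intro z
    rw [adRep_ι, map_sub, map_mul, map_mul, hσ, hι]
    simp only [map_sum, map_smul, LinearMap.sum_apply, LinearMap.smul_apply, adRep_ι,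
      Finset.sum_mul, Finset.mul_sum, smul_mul_assoc, mul_smul_comm, smul_sub,
      Finset.sum_sub_distrib]
  | mul a b ha hb =>
    intro z
    simp only [map_mul, Module.End.mul_apply, ha, hb]
  | add a b ha hb =>
    intro z
    simp only [map_add, LinearMap.add_apply, ha, hb]

variable (φ : FreeAlgebra K (Fin 2) →ₐ[K] R) (σ : R →ₐ[K] R)
  (g : Matrix.GeneralLinearGroup (Fin 2) K) (hσ : ∀ a, σ (φ a) = φ (freeAction K 2 g a))

include hσ

/-- The source of every determinant twist: one for each factor `w`, so one in the first family and
two in the second. -/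
theorem map_genComm_of_comp_eq :
    σ (genComm φ) = (Matrix.GeneralLinearGroup.det g : K) • genComm φ := by
  have hι : ∀ j, freeAction K 2 g (FreeAlgebra.ι K j) = ∑ i, (g i j : K) • FreeAlgebra.ι K i :=
    fun j => by simp [freeAction]
  simp only [genComm, map_sub, map_mul, hσ, hι, map_add, map_smul, Fin.sum_univ_two,
    Matrix.GeneralLinearGroup.val_det_apply, Matrix.det_fin_two, add_mul, mul_add, smul_mul_assoc,
    mul_smul_comm]
  module

theorem map_adComm_symD [CharZero K] (d : ℕ) (f : MvPolynomial (Fin 2) K) :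
    σ (adComm φ (symD K 2 d f)) = (Matrix.GeneralLinearGroup.det g : K) •
      adComm φ (symD K 2 d (polyAction K 2 g f)) := by
  change σ (adRep φ _ _) = _ • adRep φ _ _
  rw [map_adRep_of_comp_eq φ σ g hσ, map_genComm_of_comp_eq φ σ g hσ, map_smul, freeAction_symD]

end Equivariance

/-! ### The comparison map and its bijectivity modulo the next ideal. -/

section Comparison

open MvPolynomial TensorProduct DirectSum

variable (K : Type*) [Field K]

theorem toPIQuot_mul_eq_zero {a b : FreeAlgebra K (Fin 2)} (ha : a ∈ M K (FreeAlgebra K (Fin 2)) 2)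
    (hb : b ∈ M K (FreeAlgebra K (Fin 2)) 3) : toPIQuot K (a * b) = 0 := by
  have h : a * b ∈ mulIdeal K (FreeAlgebra K (Fin 2)) 2 3 := mul_mem_mulIdeal ha hb
  exact Ideal.Quotient.eq_zero_iff_mem.2 h

theorem PIQuot_mul_eq_zero : ∀ a ∈ M K (PIQuot K (FreeAlgebra K (Fin 2)) 2 3) 2,
    ∀ b ∈ M K (PIQuot K (FreeAlgebra K (Fin 2)) 2 3) 3, a * b = 0 :=
  mul_eq_zero_of_surjective (toPIQuot K) (Ideal.Quotient.mkₐ_surjective K _) fun _ ha _ hb =>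
    toPIQuot_mul_eq_zero K ha hb

/-- The symmetrization map on the direct sum of all symmetric powers. -/
noncomputable def symSum : (⨁ i : ℕ, Y₂ K i 0) →ₗ[K] PIQuot K (FreeAlgebra K (Fin 2)) 2 3 :=
  DirectSum.toModule K ℕ _ fun i =>
    (toPIQuot K).toLinearMap ∘ₗ symD K 2 i ∘ₗ (homogeneousSubmodule (Fin 2) K (i - 0)).subtype

theorem symSum_of (i : ℕ) (q : Y₂ K i 0) :
    symSum K (DirectSum.lof K ℕ (fun i => Y₂ K i 0) i q)
      = toPIQuot K (symD K 2 i (q : MvPolynomial (Fin 2) K)) := by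
  simp [symSum]

variable {K}

/-- The bilinear pairing of a linear map on polynomials with the symmetrization map, by right
multiplication. -/
noncomputable def pairing (Θ : MvPolynomial (Fin 2) K →ₗ[K] PIQuot K (FreeAlgebra K (Fin 2)) 2 3)
    (d : ℕ) : (⨁ i : ℕ, Y₂ K i 0) ⊗[K] Y₂ K (d + 1) 1 →ₗ[K]
      PIQuot K (FreeAlgebra K (Fin 2)) 2 3 :=
  TensorProduct.lift ((LinearMap.mul K _).flip.compl₁₂ (symSum K)
    (Θ ∘ₗ (homogeneousSubmodule (Fin 2) K (d + 1 - 1)).subtype))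

theorem pairing_tmul (Θ : MvPolynomial (Fin 2) K →ₗ[K] PIQuot K (FreeAlgebra K (Fin 2)) 2 3)
    (d : ℕ) (q : ⨁ i : ℕ, Y₂ K i 0) (f : Y₂ K (d + 1) 1) :
    pairing Θ d (q ⊗ₜ f) = Θ f * symSum K q := by
  simp [pairing]

theorem pairing_mem {Θ : MvPolynomial (Fin 2) K →ₗ[K] PIQuot K (FreeAlgebra K (Fin 2)) 2 3} {d r : ℕ}
    (h : ∀ f, Θ f ∈ M K (PIQuot K (FreeAlgebra K (Fin 2)) 2 3) r)
    (z : (⨁ i : ℕ, Y₂ K i 0) ⊗[K] Y₂ K (d + 1) 1) :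
    pairing Θ d z ∈ M K (PIQuot K (FreeAlgebra K (Fin 2)) 2 3) r := by
  induction z with
  | zero => simp
  | tmul q f =>
    rw [pairing_tmul]
    exact mul_mem_M_right (h _) _
  | add x y hx hy =>
    rw [map_add]
    exact Submodule.add_mem _ hx hy

theorem coe_Y₂rep_apply (a b : ℕ) (g : Matrix.GeneralLinearGroup (Fin 2) K) (f : Y₂ K a b) :
    (Y₂rep K a b g f : MvPolynomial (Fin 2) K)
      = (Matrix.GeneralLinearGroup.det g : K) ^ b • polyAction K 2 g f := rfl

theorem quotAction_toPIQuot (g : Matrix.GeneralLinearGroup (Fin 2) K) (a : FreeAlgebra K (Fin 2)) :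
    quotAction (freeAction K 2) 2 3 g (toPIQuot K a) = toPIQuot K (freeAction K 2 g a) := rfl

theorem quotAction_symSum (g : Matrix.GeneralLinearGroup (Fin 2) K) (q : ⨁ i : ℕ, Y₂ K i 0) :
    quotAction (freeAction K 2) 2 3 g (symSum K q)
      = symSum K (Representation.directSum (fun i : ℕ => Y₂rep K i 0) g q) := by
  have h : (quotAction (freeAction K 2) 2 3 g).toLinearMap ∘ₗ symSum K
      = symSum K ∘ₗ Representation.directSum (fun i : ℕ => Y₂rep K i 0) g := by
    refine DirectSum.linearMap_ext K fun i => LinearMap.ext fun q => ?_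
    simp only [LinearMap.comp_apply, AlgHom.toLinearMap_apply, symSum_of,
      Representation.directSum_apply, DirectSum.lmap_lof, coe_Y₂rep_apply, pow_zero, one_smul]
    rw [quotAction_toPIQuot, freeAction_symD]
  exact LinearMap.congr_fun h q

theorem quotAction_pairing (g : Matrix.GeneralLinearGroup (Fin 2) K) {d : ℕ}
    {Θ : MvPolynomial (Fin 2) K →ₗ[K] PIQuot K (FreeAlgebra K (Fin 2)) 2 3}
    {τ : Y₂ K (d + 1) 1 →ₗ[K] Y₂ K (d + 1) 1}
    (h : ∀ f : Y₂ K (d + 1) 1, quotAction (freeAction K 2) 2 3 g (Θ f) = Θ (τ f))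
    (z : (⨁ i : ℕ, Y₂ K i 0) ⊗[K] Y₂ K (d + 1) 1) :
    quotAction (freeAction K 2) 2 3 g (pairing Θ d z) = pairing Θ d
      (TensorProduct.map (Representation.directSum (fun i : ℕ => Y₂rep K i 0) g) τ z) := by
  induction z with
  | zero => simp
  | tmul q f => rw [TensorProduct.map_tmul, pairing_tmul, pairing_tmul, map_mul, h, quotAction_symSum]
  | add x y hx hy => simp only [map_add, hx, hy]

variable (K)

/-- Contraction of the one-dimensional module `Y₂ K 1 1`. -/
noncomputable def detContract (d : ℕ) : Y₂ K (d + 1) 1 ⊗[K] Y₂ K 1 1 →ₗ[K] Y₂ K (d + 1) 1 :=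
  (TensorProduct.rid K _).toLinearMap ∘ₗ
    LinearMap.lTensor _ (lcoeff K 0 ∘ₗ (homogeneousSubmodule (Fin 2) K (1 - 1)).subtype)

variable {K}

theorem detContract_tmul (d : ℕ) (f : Y₂ K (d + 1) 1) (c : Y₂ K 1 1) :
    detContract K d (f ⊗ₜ c) = coeff 0 (c : MvPolynomial (Fin 2) K) • f := by
  simp [detContract]

theorem detContract_injective (d : ℕ) : Function.Injective (detContract K d) := by
  refine (TensorProduct.rid K _).injective.comp
    (Module.Flat.lTensor_preserves_injective_linearMap _ ?_)
  rw [← LinearMap.ker_eq_bot, LinearMap.ker_eq_bot']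
  rintro ⟨c, hc⟩ h
  obtain ⟨t, rfl⟩ : ∃ t, c = C t := ⟨_, totalDegree_eq_zero_iff_eq_C.1
    (Nat.le_zero.1 (((mem_homogeneousSubmodule 0 c).1 hc).totalDegree_le))⟩
  have : t = 0 := by simpa using h
  subst this
  ext1
  simp

/-- `Y₂ K 1 1` is the line `det`, so contracting it away leaves an extra factor `det g`. -/
theorem detContract_comp_map (d : ℕ) (g : Matrix.GeneralLinearGroup (Fin 2) K) :
    detContract K d ∘ₗ TensorProduct.map (Y₂rep K (d + 1) 1 g) (Y₂rep K 1 1 g)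
      = ((Matrix.GeneralLinearGroup.det g : K) • Y₂rep K (d + 1) 1 g) ∘ₗ detContract K d := by
  refine TensorProduct.ext' fun f c => ?_
  simp only [LinearMap.comp_apply, TensorProduct.map_tmul, detContract_tmul, coe_Y₂rep_apply,
    coeff_smul, coeff_zero_polyAction, LinearMap.smul_apply, map_smul, smul_smul, smul_eq_mul,
    pow_one, mul_comm]

/-- The symmetrized iterated commutators of length `d + 2`. -/
noncomputable def commMap (d : ℕ) :
    MvPolynomial (Fin 2) K →ₗ[K] PIQuot K (FreeAlgebra K (Fin 2)) 2 3 :=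
  adComm (toPIQuot K) ∘ₗ symD K 2 d

/-- The products of the symmetrized iterated commutators of length `d + 2` and the commutator of
the generators. -/
noncomputable def commMulMap (d : ℕ) :
    MvPolynomial (Fin 2) K →ₗ[K] PIQuot K (FreeAlgebra K (Fin 2)) 2 3 :=
  LinearMap.mulRight K (genComm (toPIQuot K)) ∘ₗ commMap d

variable (K)

/-- The map that compares the tensor product with the ideal `M_{m+5}` of `A_2 / (M_2 M_3)`. -/
noncomputable def comparison (m : ℕ) :
    (⨁ i : ℕ, Y₂ K i 0) ⊗[K] (Y₂ K (m + 3 + 1) 1 × (Y₂ K (m + 1 + 1) 1 ⊗[K] Y₂ K 1 1)) →ₗ[K]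
      PIQuot K (FreeAlgebra K (Fin 2)) 2 3 :=
  (pairing (commMap (m + 3)) (m + 3)).coprod
      (pairing (commMulMap (m + 1)) (m + 1) ∘ₗ LinearMap.lTensor _ (detContract K (m + 1))) ∘ₗ
    (TensorProduct.prodRight K K _ _ _).toLinearMap

variable {K}

theorem adComm_symD_mem_adTail (d : ℕ) (f : MvPolynomial (Fin 2) K) :
    adComm (toPIQuot K) (symD K 2 d f) ∈ adTail (toPIQuot K) d := by
  refine ⟨_, ?_, rfl⟩
  rw [← mul_one (symD K 2 d f)]
  exact Submodule.mul_mem_mul (symD_mem d f) Submodule.mem_top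

theorem comparison_mem (m : ℕ) (z) :
    comparison K m z ∈ M K (PIQuot K (FreeAlgebra K (Fin 2)) 2 3) (m + 5) := by
  rw [comparison, LinearMap.comp_apply, LinearMap.coprod_apply]
  refine Submodule.add_mem _ (pairing_mem (fun f => ?_) _) (pairing_mem (fun f => ?_) _)
  · exact L_le_M _ (adTail_le_L _ (adComm_symD_mem_adTail _ f))
  · refine adCommIdeal_le_M (φ := toPIQuot K) (PIQuot_mul_eq_zero K) m ?_
    have := mul_mem_adCommIdeal (adComm_symD_mem_adTail (m + 1) f) 1
    rwa [mul_one] at this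

/-- The polynomial that detects an element of the tensor product. -/
noncomputable def detect (d : ℕ) : (⨁ i : ℕ, Y₂ K i 0) ⊗[K] Y₂ K (d + 1) 1 →ₗ[K]
    MvPolynomial (Fin 2) (MvPolynomial (Fin 2) K) :=
  (algebraTensorAlgEquiv K (MvPolynomial (Fin 2) K)).toLinearMap.restrictScalars K ∘ₗ
    TensorProduct.map (DirectSum.coeLinearMap (homogeneousSubmodule (Fin 2) K))
      (homogeneousSubmodule (Fin 2) K (d + 1 - 1)).subtype

attribute [local instance] MvPolynomial.gradedAlgebra in
-- Polynomials are the internal direct sum of their homogeneous parts, and injections of vector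
-- spaces stay injective under tensor products.
theorem detect_injective (d : ℕ) : Function.Injective (detect (K := K) d) := by
  refine (algebraTensorAlgEquiv K (MvPolynomial (Fin 2) K)).injective.comp
    (TensorProduct.map_injective_of_flat_flat _ _ ?_ (Submodule.subtype_injective _))
  exact (DirectSum.Decomposition.isInternal (homogeneousSubmodule (Fin 2) K)).injective

theorem detect_lof_tmul (d i : ℕ) (q : Y₂ K i 0) (f : Y₂ K (d + 1) 1) :
    detect d (DirectSum.lof K ℕ (fun i => Y₂ K i 0) i q ⊗ₜ f)
      = C (q : MvPolynomial (Fin 2) K) * MvPolynomial.map (algebraMap K (MvPolynomial (Fin 2) K)) f := by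
  rw [← smul_eq_C_mul, ← algebraTensorAlgEquiv_tmul]
  have h : DirectSum.coeLinearMap (homogeneousSubmodule (Fin 2) K)
      (DirectSum.lof K ℕ (fun i => Y₂ K i 0) i q) = (q : MvPolynomial (Fin 2) K) :=
    DirectSum.coeLinearMap_lof (homogeneousSubmodule (Fin 2) K) i q
  rw [← h]
  rfl

theorem isHomogeneous_detect (d : ℕ) (z : (⨁ i : ℕ, Y₂ K i 0) ⊗[K] Y₂ K (d + 1) 1) :
    (detect d z).IsHomogeneous d := by
  induction z with
  | zero =>
    rw [map_zero]
    exact isHomogeneous_zero _ _ _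
  | tmul q f =>
    change (algebraTensorAlgEquiv K _ (_ ⊗ₜ _)).IsHomogeneous d
    rw [algebraTensorAlgEquiv_tmul, smul_eq_C_mul]
    exact (((mem_homogeneousSubmodule _ _).1 f.2).map _).C_mul _
  | add x y hx hy =>
    rw [map_add]
    exact hx.add hy

/-- The product is homogeneous of degree `d + 1` in the outer variables, one too small for a nonzero
element of that power. -/
theorem eq_zero_of_detect_mem {d : ℕ} {z : (⨁ i : ℕ, Y₂ K i 0) ⊗[K] Y₂ K (d + 1) 1}
    (h : detect d z * X 0 ∈ idealOfVars (Fin 2) (MvPolynomial (Fin 2) K) ^ (d + 2)) : z = 0 := by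
  refine detect_injective d ?_
  rw [map_zero]
  have h1 : (detect d z * X 0).IsHomogeneous (d + 1) :=
    (isHomogeneous_detect d z).mul (isHomogeneous_X _ 0)
  rw [mem_pow_idealOfVars_iff'] at h
  have h2 : detect d z * X 0 = 0 := by
    ext1 x
    rw [coeff_zero]
    by_cases hx : x.degree = d + 1
    · exact h x (by omega)
    · exact h1.coeff_eq_zero hx
  exact (mul_eq_zero.1 h2).resolve_right (X_ne_zero 0)

section CharZero

variable [CharZero K]

theorem triRepQuot_pairing_commMap (d : ℕ) (z : (⨁ i : ℕ, Y₂ K i 0) ⊗[K] Y₂ K (d + 1) 1) :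
    triRepQuot K (pairing (commMap d) d z) 0 1 = detect d z * X 0 := by
  have h : Matrix.entryLinearMap K _ 0 1 ∘ₗ (triRepQuot K).toLinearMap ∘ₗ pairing (commMap d) d
      = LinearMap.mulRight K (X 0) ∘ₗ detect d := by
    refine TensorProduct.ext (DirectSum.linearMap_ext K fun i => LinearMap.ext fun q =>
      LinearMap.ext fun f => ?_)
    change triRepQuot K (pairing (commMap d) d (DirectSum.lof K ℕ (fun i => Y₂ K i 0) i q ⊗ₜ f)) 0 1
      = detect d (DirectSum.lof K ℕ (fun i => Y₂ K i 0) i q ⊗ₜ f) * X 0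
    rw [pairing_tmul, symSum_of, map_mul_apply_zero_one _ (isTri_triRepQuot K), detect_lof_tmul,
      triRepQuot_symD K (show (q : MvPolynomial (Fin 2) K).IsHomogeneous i from q.2)]
    · have hf : (f : MvPolynomial (Fin 2) K).IsHomogeneous d := f.2
      have h := triRepQuot_adComm_symD K hf
      change triRepQuot K (commMap d f) 0 1 = _ at h
      change triRepQuot K (commMap d f) 0 1 * _ = _
      rw [h]
      ring
    · exact adTail_le_M_two d (adComm_symD_mem_adTail d _)
  exact LinearMap.congr_fun h z

theorem triRepQuot_pairing_commMulMap (d : ℕ) (z : (⨁ i : ℕ, Y₂ K i 0) ⊗[K] Y₂ K (d + 1) 1) :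
    triRepQuot K (pairing (commMulMap d) d z) 0 1 = 0 ∧
      triRepQuot K (pairing (commMulMap d) d z) 0 3 = detect d z * X 0 := by
  have hw : genComm (toPIQuot K) ∈ M K _ 2 := L_le_M 2 (genComm_mem _)
  have h1 : Matrix.entryLinearMap K _ 0 1 ∘ₗ (triRepQuot K).toLinearMap ∘ₗ pairing (commMulMap d) d
      = 0 := by
    refine TensorProduct.ext (DirectSum.linearMap_ext K fun i => LinearMap.ext fun q =>
      LinearMap.ext fun f => ?_)
    change triRepQuot K (pairing (commMulMap d) d (DirectSum.lof K ℕ (fun i => Y₂ K i 0) i q ⊗ₜ f))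
      0 1 = 0
    rw [pairing_tmul]
    exact map_mul_mul_apply_zero_one _ (isTri_triRepQuot K)
      (adTail_le_M_two d (adComm_symD_mem_adTail d _)) hw _
  have h2 : Matrix.entryLinearMap K _ 0 3 ∘ₗ (triRepQuot K).toLinearMap ∘ₗ pairing (commMulMap d) d
      = LinearMap.mulRight K (X 0) ∘ₗ detect d := by
    refine TensorProduct.ext (DirectSum.linearMap_ext K fun i => LinearMap.ext fun q =>
      LinearMap.ext fun f => ?_)
    change triRepQuot K (pairing (commMulMap d) d (DirectSum.lof K ℕ (fun i => Y₂ K i 0) i q ⊗ₜ f))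
      0 3 = detect d (DirectSum.lof K ℕ (fun i => Y₂ K i 0) i q ⊗ₜ f) * X 0
    rw [pairing_tmul, symSum_of]
    refine (map_mul_mul_apply_zero_three _ (isTri_triRepQuot K)
      (adTail_le_M_two d (adComm_symD_mem_adTail d _)) hw _).trans ?_
    have hf : (f : MvPolynomial (Fin 2) K).IsHomogeneous d := f.2
    have hq : (q : MvPolynomial (Fin 2) K).IsHomogeneous i := q.2
    rw [triRepQuot_adComm_symD K hf, (triRepQuot_genComm K).2, triRepQuot_symD K hq,
      detect_lof_tmul]
    ring
  exact ⟨LinearMap.congr_fun h1 z, LinearMap.congr_fun h2 z⟩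

theorem eq_zero_of_comparison_mem (m : ℕ) (z)
    (hz : comparison K m z ∈ M K (PIQuot K (FreeAlgebra K (Fin 2)) 2 3) (m + 6)) : z = 0 := by
  rw [← (TensorProduct.prodRight K K _ _ _).map_eq_zero_iff]
  rw [comparison, LinearMap.comp_apply, LinearEquiv.coe_coe] at hz
  generalize TensorProduct.prodRight K K _ _ _ z = y at hz ⊢
  obtain ⟨y1, y2⟩ := y
  rw [LinearMap.coprod_apply, LinearMap.comp_apply] at hz
  -- Entry (0,1) lies in `I ^ (m + 5)` and sees only `y1`, of degree `m + 4` there. Once `y1 = 0`,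
  -- entry (0,3) lies in `I ^ (m + 3)` and sees `y2` in degree `m + 2`.
  obtain ⟨-, -, h1, -, h3⟩ := map_M_mem_rowFiltration _ (isTri_triRepQuot K) (m + 3) hz
  dsimp only at h1 h3
  rw [map_add, Matrix.add_apply] at h1 h3
  rw [triRepQuot_pairing_commMap, (triRepQuot_pairing_commMulMap _ _).1, add_zero] at h1
  have hy1 : y1 = 0 := eq_zero_of_detect_mem h1
  subst hy1
  rw [map_zero, map_zero, Matrix.zero_apply, zero_add, (triRepQuot_pairing_commMulMap _ _).2] at h3
  have hy2 : y2 = 0 := by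
    refine Module.Flat.lTensor_preserves_injective_linearMap _ (detContract_injective (m + 1)) ?_
    rw [map_zero]
    exact eq_zero_of_detect_mem h3
  rw [hy2]
  rfl

theorem exists_sub_comparison_mem (m : ℕ) {x : PIQuot K (FreeAlgebra K (Fin 2)) 2 3}
    (hx : x ∈ M K (PIQuot K (FreeAlgebra K (Fin 2)) 2 3) (m + 5)) :
    ∃ z, x - comparison K m z ∈ M K (PIQuot K (FreeAlgebra K (Fin 2)) 2 3) (m + 6) := by
  have key : M K (PIQuot K (FreeAlgebra K (Fin 2)) 2 3) (m + 5)
      ≤ M K (PIQuot K (FreeAlgebra K (Fin 2)) 2 3) (m + 6) ⊔ LinearMap.range (comparison K m) := by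
    refine M_le_of_symD_mem (φ := toPIQuot K) (Ideal.Quotient.mkₐ_surjective K _)
      (PIQuot_mul_eq_zero K) le_sup_left
      (fun f hf i q hq => Submodule.mem_sup_right ?_) (fun f hf i q hq => Submodule.mem_sup_right ?_)
    · refine ⟨DirectSum.lof K ℕ (fun i => Y₂ K i 0) i ⟨q, hq⟩ ⊗ₜ (⟨f, hf⟩, 0), ?_⟩
      rw [comparison, LinearMap.comp_apply, LinearEquiv.coe_coe, TensorProduct.prodRight_tmul,
        LinearMap.coprod_apply, TensorProduct.tmul_zero, map_zero, add_zero, pairing_tmul, symSum_of]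
      rfl
    · refine ⟨DirectSum.lof K ℕ (fun i => Y₂ K i 0) i ⟨q, hq⟩ ⊗ₜ
        (0, ⟨f, hf⟩ ⊗ₜ ⟨1, isHomogeneous_one _ _⟩), ?_⟩
      rw [comparison, LinearMap.comp_apply, LinearEquiv.coe_coe, TensorProduct.prodRight_tmul,
        LinearMap.coprod_apply, TensorProduct.tmul_zero, map_zero, zero_add, LinearMap.comp_apply,
        LinearMap.lTensor_tmul, detContract_tmul, pairing_tmul, symSum_of]
      simp only [coeff_zero_one, one_smul]
      rfl
  obtain ⟨y, hy, _, ⟨z, rfl⟩, h⟩ := Submodule.mem_sup.1 (key hx)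
  refine ⟨z, ?_⟩
  rw [← h, add_sub_cancel_right]
  exact hy

theorem quotAction_comparison (m : ℕ) (g : Matrix.GeneralLinearGroup (Fin 2) K) (z) :
    quotAction (freeAction K 2) 2 3 g (comparison K m z) = comparison K m
      (Representation.tprod (Representation.directSum fun i : ℕ => Y₂rep K i 0)
        (Representation.prod (Y₂rep K (m + 3 + 1) 1)
          (Representation.tprod (Y₂rep K (m + 1 + 1) 1) (Y₂rep K 1 1))) g z) := by
  have h1 : ∀ f : Y₂ K (m + 3 + 1) 1, quotAction (freeAction K 2) 2 3 g (commMap (m + 3) f)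
      = commMap (m + 3) (Y₂rep K (m + 3 + 1) 1 g f) := by
    intro f
    rw [coe_Y₂rep_apply, pow_one, map_smul]
    exact map_adComm_symD (toPIQuot K) _ g (quotAction_toPIQuot g) _ _
  have h2 : ∀ f : Y₂ K (m + 1 + 1) 1, quotAction (freeAction K 2) 2 3 g (commMulMap (m + 1) f)
      = commMulMap (m + 1)
        (((Matrix.GeneralLinearGroup.det g : K) • Y₂rep K (m + 1 + 1) 1 g) f : Y₂ K (m + 1 + 1) 1) := by
    intro f
    rw [LinearMap.smul_apply, Submodule.coe_smul, coe_Y₂rep_apply, pow_one, map_smul, map_smul]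
    change quotAction (freeAction K 2) 2 3 g (adComm (toPIQuot K) _ * genComm (toPIQuot K)) = _
    rw [map_mul, map_adComm_symD (toPIQuot K) _ g (quotAction_toPIQuot g),
      map_genComm_of_comp_eq (toPIQuot K) _ g (quotAction_toPIQuot g), smul_mul_smul_comm, smul_smul]
    rfl
  induction z with
  | zero => simp
  | add x y hx hy => simp only [map_add, hx, hy]
  | tmul q p =>
    obtain ⟨p1, p2⟩ := p
    rw [Representation.tprod_apply, TensorProduct.map_tmul]
    simp only [comparison, LinearMap.comp_apply, LinearEquiv.coe_coe, TensorProduct.prodRight_tmul,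
      LinearMap.coprod_apply, map_add, LinearMap.lTensor_tmul]
    rw [quotAction_pairing g h1, quotAction_pairing g h2, TensorProduct.map_tmul,
      TensorProduct.map_tmul]
    congr 3
    exact (LinearMap.congr_fun (detContract_comp_map (m + 1) g) p2).symm

end CharZero

end Comparison

end LCS

/-! ### The structure theorem. -/

theorem mainTheorem9 (K : Type*) [Field K] [CharZero K] (r : ℕ) (hr : 4 < r) :
    Nonempty (Representation.Equiv
      (LCS.nQuotRep K 2 2 3 r)
      (Representation.tprod
        (Representation.directSum fun i : ℕ => LCS.Y₂rep K i 0)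
        (Representation.prod
          (LCS.Y₂rep K (r - 1) 1)
          (Representation.tprod (LCS.Y₂rep K (r - 3) 1) (LCS.Y₂rep K 1 1))))) := by
  -- With `r = m + 5` the truncated differences `r - 1` and `r - 3` reduce to `m + 4` and `m + 2`,
  -- the indices used in `comparison`.
  obtain ⟨m, rfl⟩ := Nat.exists_eq_add_of_le' hr
  have hΨ : Function.Bijective
      (((LCS.M K (LCS.PIQuot K (FreeAlgebra K (Fin 2)) 2 3) (m + 5 + 1)).submoduleOf
        (LCS.M K (LCS.PIQuot K (FreeAlgebra K (Fin 2)) 2 3) (m + 5))).mkQ ∘ₗ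
        (LCS.comparison K m).codRestrict _ (LCS.comparison_mem m)) := by
    constructor
    · refine LCS.injective_of_map_eq_zero _ fun z hz => ?_
      rw [LinearMap.comp_apply, Submodule.mkQ_apply, Submodule.Quotient.mk_eq_zero] at hz
      exact LCS.eq_zero_of_comparison_mem m z hz
    · intro y
      obtain ⟨⟨x, hx⟩, rfl⟩ := Submodule.mkQ_surjective _ y
      obtain ⟨z, hz⟩ := LCS.exists_sub_comparison_mem m hx
      refine ⟨z, ?_⟩
      rw [LinearMap.comp_apply, Submodule.mkQ_apply, Submodule.mkQ_apply, eq_comm,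
        Submodule.Quotient.eq]
      exact hz
  refine ⟨(Representation.Equiv.mk (LinearEquiv.ofBijective _ hΨ) fun g => ?_).symm⟩
  refine LinearMap.ext fun z => ?_
  refine congrArg (Submodule.mkQ _) (Subtype.ext ?_)
  exact (LCS.quotAction_comparison m g z).symm
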